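/- Let $G=(V,E)$ be a finite connected trivalent multigraph with at least one vertex (loops and multiple edges are allowed; a loop counts twice in the valence), and let $\Gamma$ be an oriented ribbon graph of $G$, i.e. a cyclic order of the three half-edges at each vertex. A perfect matching of $G$ is a set $M\subseteq E$ of non-loop edges such that every vertex is incident to exactly one edge of $M$. **States.** Split each edge into two half-edges. For $\alpha\in\{0,1\}^{\{\text{half-edges}\}}$ the state $\Gamma_\alpha$ is the collection of circles obtained from the boundary of the ribbon surface of $\Gamma$ by letting the two boundary strands along each half-edge $h$ with $\alpha_h=1$ cross. A vertex state $\nu\in\{0,1\}^{V}$ is identified with the state $\alpha$ for which $\alpha_h=\nu_v$ for each half-edge $h$ at $v$; put $|\nu|=\sum_v\nu_v$. **Filtered $n$-color vertex homology.** Let $m=\lfloor n/2\rfloor$ and $\widehat V=\mathbb C[x]/(x^n-1)$, and assign to each state the tensor power of $\widehat V$ over its circles. Changing one coordinate of $\alpha$ from $0$ to $1$ merges two circles, splits one circle, or keeps one circle; the corresponding map $\widehat\partial$ is the identity on the other circles and, respectively, $$x^i\otimes x^j\mapsto x^{i+j},\qquad x^k\mapsto\sum_{\substack{0\le i,j<n\\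 i+j\equiv k+2m\ (n)}}x^i\otimes x^j,\qquad x^k\mapsto\sqrt n\,x^{k+m}.$$ If $\nu'$ is obtained from $\nu$ by changing the coordinate of one vertex $v$ from $0$ to $1$, let $\widehat\delta_{\nu\nu'}:\widehat V_\nu\to\widehat V_{\nu'}$ be the composition of the three maps $\widehat\partial$ that change the three half-edges at $v$ one after the other (the order does not matter). With $\widehat C^i_n(\Gamma)=\bigoplus_{|\nu|=i}\widehat V_\nu$ and $\widehat\delta=\sum\pm\widehat\delta_{\nu\nu'}$, where for a fixed order of the vertices the sign is $(-1)^{\#\{u<v\,:\,\nu_u=1\}}$, let $\widehat{VCH}{}^i_n(\Gamma)=H^i(\widehat C_n^*(\Gamma),\widehat\delta)$. **Total matching polynomial.** Let $\lambda=e^{2\pi \mathrm i/n}$ and give each $\widehat V_\nu$ the Hermitian metric in which the tensor products of the colors $c_i=\frac1n\sum_{k=0}^{n-1}\lambda^{ik}x^k$ $(0\le i<n)$ are orthonormal. Let $\widehat{\mathcal{VCH}}_n(\Gamma_\nu)\subseteq\widehat V_\nu$ be the common kernel of all maps $\widehat\delta_{\nu\nu'}$ out of $\widehat V_\nu$ and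 of the adjoints of all maps $\widehat\delta_{\nu'\nu}$ into $\widehat V_\nu$. Put $$TM(\Gamma,n,t)=\sum_{\nu}t^{|\nu|}\dim\widehat{\mathcal{VCH}}_n(\Gamma_\nu),\qquad TM(\Gamma,n)=TM(\Gamma,n,1).$$ **Statement.** The number $TM(\Gamma,2)$ is the same for all oriented ribbon graphs $\Gamma$ of $G$; call it $TM(G,2)$. The following are equivalent: 1. $G$ has a perfect matching. 2. $TM(G,2)>0$. 3. $\dim\widehat{VCH}{}^i_2(\Gamma)>0$ for some $i$. -/

import Mathlib

open scoped ComplexConjugate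

noncomputable section

/-- A multigraph with vertex set `V` and edge set `E`; loops and multiple edges are allowed.
`G.ends e false` and `G.ends e true` are the two (possibly equal) ends of the edge `e`. -/
structure Multigraph (V E : Type*) where
  ends : E → Bool → V

namespace Multigraph

variable {V E : Type*}

/-- The vertex at which a half-edge is attached. The half-edges of the edge `e` are
`(e, false)` and `(e, true)`. -/
def vert (G : Multigraph V E) (h : E × Bool) : V := G.ends h.1 h.2

/-- Connectedness; in particular there is at least one vertex. -/
def Connected (G : Multigraph V E) : Prop :=
  (SimpleGraph.fromRel fun v w => ∃ e, G.ends e false = v ∧ G.ends e true = w).Connected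

/-- Every vertex has exactly three half-edges (a loop counts twice). -/
def Trivalent (G : Multigraph V E) : Prop :=
  ∀ v, Nat.card {h : E × Bool // G.vert h = v} = 3

/-- A set of non-loop edges such that each vertex is incident to exactly one of them. -/
def IsPerfectMatching (G : Multigraph V E) (M : Set E) : Prop :=
  (∀ e ∈ M, G.ends e false ≠ G.ends e true) ∧
    ∀ v, ∃! e, e ∈ M ∧ ∃ b, G.ends e b = v

/-- An oriented ribbon graph of `G`: a cyclic order (counterclockwise, say) of the half-edges at
each vertex. The surface is obtained by gluing untwisted bands to oriented vertex discs. -/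
structure OrientedRibbonGraph (G : Multigraph V E) where
  rot : Equiv.Perm (E × Bool)
  vert_rot : ∀ h, G.vert (rot h) = G.vert h
  sameCycle : ∀ h h', G.vert h = G.vert h' → rot.SameCycle h h'

/-- The auxiliary orders used to write down the differential of a trivalent ribbon graph: an order
of the vertices (for the signs) and, at each vertex, an order of its three half-edges (the order
in which they are crossed, which picks one of the six three-edge paths). -/
structure Labelling (G : Multigraph V E) [Fintype V] where
  vertex : V ≃ Fin (Fintype.card V)
  halfEdge : ∀ v, Fin 3 ≃ {h : E × Bool // G.vert h = v}

end Multigraph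

/-! ### The local maps on `ℂ[x]/(xⁿ - 1)`, by their coefficients on monomials

In each case the first summand is the degree-preserving map of the bigraded theory
(`m`, `Δ`, `η`) and the second one is the map that raises the quantum degree by `n`
(`m~`, `Δ~`, `η~`). The integer called `m` in the formulas for `Δ` and `η` is `n / 2`. -/

/-- Coefficient of `x ^ k` in the product of `x ^ i` and `x ^ j`. -/
def mulCoeff (n : ℕ) (i j k : Fin n) : ℂ :=
  (if (i + j : ℕ) = k then 1 else 0) + (if (i + j : ℕ) = k + n then 1 else 0)

/-- Coefficient of `x ^ i ⊗ x ^ j` in the coproduct of `x ^ k`. -/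
def comulCoeff (n : ℕ) (k i j : Fin n) : ℂ :=
  (if (i + j : ℕ) = k + 2 * (n / 2) then 1 else 0) +
    (if (i + j + n : ℕ) = k + 2 * (n / 2) then 1 else 0)

/-- Coefficient of `x ^ l` in the image of `x ^ k` under the one-circle map. -/
def etaCoeff (n : ℕ) (k l : Fin n) : ℂ :=
  (if (l : ℕ) = k + n / 2 then (Real.sqrt n : ℂ) else 0) +
    (if (l + n : ℕ) = k + n / 2 then (Real.sqrt n : ℂ) else 0)

/-- For circles indexed by `ι`, the tensor power of `ℂ[x]/(xⁿ - 1)` over `ι`: the complex vector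
space with basis the monomials `⨂ c, x ^ (a c)`, `a : ι → Fin n`, a vector being given by its
coordinates in this basis. -/
abbrev TensorPow (n : ℕ) (ι : Type*) : Type _ := (ι → Fin n) → ℂ

/-- The color `c_i = (1/n) ∑_k λ ^ (i k) x ^ k`, with `λ = exp (2 π i / n)`, on every circle:
the coordinates of `⨂ c, c_{I c}` in the monomial basis. -/
def colorVec (n : ℕ) {ι : Type*} [Fintype ι] (I : ι → Fin n) : TensorPow n ι :=
  fun a => ∏ c, (1 / (n : ℂ)) *
    Complex.exp (2 * Real.pi * Complex.I / n) ^ ((I c : ℕ) * (a c : ℕ))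

theorem color_orthogonality (n : ℕ) [NeZero n] (i j : Fin n) :
    ∑ k : Fin n, ((1 / (n : ℂ)) * Complex.exp (2 * Real.pi * Complex.I / n) ^ ((i : ℕ) * (k : ℕ))) *
      (Complex.exp (2 * Real.pi * Complex.I / n))⁻¹ ^ ((j : ℕ) * (k : ℕ)) =
        if i = j then 1 else 0 := by
  have hn : (n : ℂ) ≠ 0 := Nat.cast_ne_zero.mpr (NeZero.ne n)
  have hz := Complex.isPrimitiveRoot_exp n (NeZero.ne n)
  set z := Complex.exp (2 * Real.pi * Complex.I / n) with hzdef
  have hz0 : z ≠ 0 := Complex.exp_ne_zero _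
  have key : ∀ k : Fin n, ((1 / (n : ℂ)) * z ^ ((i : ℕ) * (k : ℕ))) * z⁻¹ ^ ((j : ℕ) * (k : ℕ)) =
      (1 / (n : ℂ)) * (z ^ (i : ℕ) * z⁻¹ ^ (j : ℕ)) ^ (k : ℕ) := by
    intro k
    rw [mul_pow, ← pow_mul, ← pow_mul, mul_assoc]
  rw [Finset.sum_congr rfl (fun k _ => key k), ← Finset.mul_sum,
    Fin.sum_univ_eq_sum_range (fun k => (z ^ (i : ℕ) * z⁻¹ ^ (j : ℕ)) ^ k)]
  split_ifs with h
  · subst h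
    have : z ^ (i : ℕ) * z⁻¹ ^ (i : ℕ) = 1 := by rw [← mul_pow, mul_inv_cancel₀ hz0, one_pow]
    simp only [this, one_pow, Finset.sum_const, Finset.card_range, nsmul_eq_mul, mul_one]
    exact one_div_mul_cancel hn
  · have hr : z ^ (i : ℕ) * z⁻¹ ^ (j : ℕ) ≠ 1 := by
      intro h1
      apply h
      apply Fin.ext
      apply hz.pow_inj i.2 j.2
      have h2 : z⁻¹ ^ (j : ℕ) * z ^ (j : ℕ) = 1 := by
        rw [← mul_pow, inv_mul_cancel₀ hz0, one_pow]
      calc z ^ (i : ℕ) = z ^ (i : ℕ) * (z⁻¹ ^ (j : ℕ) * z ^ (j : ℕ)) := by rw [h2, mul_one]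
        _ = z ^ (j : ℕ) := by rw [← mul_assoc, h1, one_mul]
    have hpow : (z ^ (i : ℕ) * z⁻¹ ^ (j : ℕ)) ^ n = 1 := by
      rw [mul_pow, ← pow_mul, ← pow_mul, mul_comm (i : ℕ), mul_comm (j : ℕ), pow_mul, pow_mul,
        inv_pow, hz.pow_eq_one]
      simp
    rw [geom_sum_eq hr, hpow]
    simp

theorem linearIndependent_colorVec (n : ℕ) [NeZero n] (ι : Type*) [Fintype ι] :
    LinearIndependent ℂ (fun I : ι → Fin n => colorVec n I) := by
  classical
  have h : IsUnit (Matrix.of fun I a : ι → Fin n => colorVec n I a) := by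
    refine IsUnit.of_mul_eq_one
      (Matrix.of fun a J : ι → Fin n =>
        ∏ c, (Complex.exp (2 * Real.pi * Complex.I / n))⁻¹ ^ ((J c : ℕ) * (a c : ℕ))) ?_
    ext I J
    simp only [Matrix.mul_apply, Matrix.of_apply, colorVec, ← Finset.prod_mul_distrib]
    have := Finset.prod_univ_sum (fun _ : ι => (Finset.univ : Finset (Fin n)))
      (fun c k => ((1 / (n : ℂ)) *
        Complex.exp (2 * Real.pi * Complex.I / n) ^ ((I c : ℕ) * (k : ℕ))) *
        (Complex.exp (2 * Real.pi * Complex.I / n))⁻¹ ^ ((J c : ℕ) * (k : ℕ)))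
    rw [Fintype.piFinset_univ] at this
    rw [← this, Finset.prod_congr rfl (fun c _ => color_orthogonality n (I c) (J c)),
      Matrix.one_apply]
    by_cases hIJ : I = J
    · simp [hIJ]
    · obtain ⟨c, hc⟩ := Function.ne_iff.mp hIJ
      rw [if_neg hIJ]
      exact Finset.prod_eq_zero (Finset.mem_univ c) (if_neg hc)
  exact Matrix.linearIndependent_rows_iff_isUnit.mpr h

/-- The color basis of the tensor power. -/
def colorBasis (n : ℕ) [NeZero n] (ι : Type*) [Fintype ι] [DecidableEq ι] :
    Module.Basis (ι → Fin n) ℂ (TensorPow n ι) :=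
  basisOfLinearIndependentOfCardEqFinrank (linearIndependent_colorVec n ι) (by simp)

/-- The adjoint for the Hermitian metrics in which the color bases are orthonormal. -/
def colorAdjoint (n : ℕ) [NeZero n] {ι κ : Type*} [Fintype ι] [DecidableEq ι] [Fintype κ]
    [DecidableEq κ] (f : TensorPow n ι →ₗ[ℂ] TensorPow n κ) :
    TensorPow n κ →ₗ[ℂ] TensorPow n ι :=
  Matrix.toLin (colorBasis n κ) (colorBasis n ι)
    (LinearMap.toMatrix (colorBasis n ι) (colorBasis n κ) f).conjTranspose

namespace Multigraph.OrientedRibbonGraph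

variable {V E : Type*} {G : Multigraph V E}

/-- The elementary arcs of the state `α` of the bubbled blowup, whose canonical perfect matching
has one edge for each half-edge of `G`. A point `(h, s)` is the point, in the middle of the band,
on the left (`s = true`) or right (`s = false`) boundary of the half-edge `h`, seen from its
vertex. A half-edge with `α h = false` is `0`-smoothed (two parallel strands), one with
`α h = true` is `1`-smoothed (two crossing strands).
* `corner`: at the vertex, the left side of `h` is joined to the right side of the next half-edge;
  each crossing exchanges the two sides on the way to the middle of the band.
* `band`: in the middle of the band, left and right are exchanged because the two half-edges of
  an edge point in opposite directions. -/
inductive Arc (Γ : G.OrientedRibbonGraph) (α : E × Bool → Bool) :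
    (E × Bool) × Bool → (E × Bool) × Bool → Prop
  | corner (h : E × Bool) : Arc Γ α (h, xor true (α h)) (Γ.rot h, xor false (α (Γ.rot h)))
  | band (e : E) (b s : Bool) : Arc Γ α ((e, b), s) ((e, !b), !s)

/-- The circles of the state `α`: the classes of the equivalence relation generated by arcs. -/
def Circle (Γ : G.OrientedRibbonGraph) (α : E × Bool → Bool) : Type _ := Quot (Γ.Arc α)

/-- The circle through a point. -/
def circle (Γ : G.OrientedRibbonGraph) (α : E × Bool → Bool) (p : (E × Bool) × Bool) :
    Γ.Circle α := Quot.mk _ p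

instance (Γ : G.OrientedRibbonGraph) (α : E × Bool → Bool) [Finite E] : Finite (Γ.Circle α) :=
  inferInstanceAs (Finite (Quot (Γ.Arc α)))

instance (Γ : G.OrientedRibbonGraph) (α : E × Bool → Bool) [Finite E] : Fintype (Γ.Circle α) :=
  Fintype.ofFinite _

instance (Γ : G.OrientedRibbonGraph) (α : E × Bool → Bool) : DecidableEq (Γ.Circle α) :=
  Classical.decEq _

open scoped Classical in
/-- Matrix coefficient, on the monomials `a` and `b`, of the local map from the state `α` to the
state `β`, where `β` is obtained from `α` by changing the half-edge `h` from a `0`- to a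
`1`-smoothing: the identity on the circles that do not pass through `h`, and on the remaining
one(s) multiplication if two circles merge, comultiplication if one circle splits, and the
one-circle map if one circle stays one circle. -/
def localCoeff (Γ : G.OrientedRibbonGraph) (n : ℕ) (h : E × Bool) (α β : E × Bool → Bool)
    (a : Γ.Circle α → Fin n) (b : Γ.Circle β → Fin n) : ℂ :=
  if ∀ p, Γ.circle α p ≠ Γ.circle α (h, false) → Γ.circle α p ≠ Γ.circle α (h, true) →
      a (Γ.circle α p) = b (Γ.circle β p) then
    if Γ.circle α (h, false) ≠ Γ.circle α (h, true) then
      mulCoeff n (a (Γ.circle α (h, false))) (a (Γ.circle α (h, true)))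
        (b (Γ.circle β (h, false)))
    else if Γ.circle β (h, false) ≠ Γ.circle β (h, true) then
      comulCoeff n (a (Γ.circle α (h, false))) (b (Γ.circle β (h, false)))
        (b (Γ.circle β (h, true)))
    else etaCoeff n (a (Γ.circle α (h, false))) (b (Γ.circle β (h, false)))
  else 0

variable [Fintype V] [DecidableEq V] [Fintype E] [DecidableEq E]

/-- The local map of an edge of the hypercube of states of the bubbled blowup. -/
def localMap (Γ : G.OrientedRibbonGraph) (n : ℕ) (h : E × Bool) (α β : E × Bool → Bool) :
    TensorPow n (Γ.Circle α) →ₗ[ℂ] TensorPow n (Γ.Circle β) :=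
  Matrix.mulVecLin (Matrix.of fun b a => Γ.localCoeff n h α β a b)

/-- The state of the bubbled blowup given by a vertex state `ν`: a vertex `1`-smoothing
`1`-smooths the three half-edges at the vertex. -/
def bubbledState (_ : G.OrientedRibbonGraph) (ν : V → Bool) : E × Bool → Bool :=
  fun h => ν (G.vert h)

/-- The vector space of the vertex state `ν`. -/
abbrev StateSpace (Γ : G.OrientedRibbonGraph) (n : ℕ) (ν : V → Bool) : Type _ :=
  TensorPow n (Γ.Circle (Γ.bubbledState ν))

/-- The map from the vertex state `ν` to `ν'`, where `ν'` is obtained from `ν` by changing the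
vertex `v` from a `0`- to a `1`-smoothing: the composition of three local maps along the path in
the bubbled blowup that changes the three half-edges at `v` one after the other. -/
def vertexMap (Γ : G.OrientedRibbonGraph) (L : G.Labelling) (n : ℕ) (v : V) (ν ν' : V → Bool) :
    Γ.StateSpace n ν →ₗ[ℂ] Γ.StateSpace n ν' :=
  let h₁ : E × Bool := L.halfEdge v 0
  let h₂ : E × Bool := L.halfEdge v 1
  let h₃ : E × Bool := L.halfEdge v 2
  let α := Γ.bubbledState ν
  let α₁ := Function.update α h₁ true
  let α₂ := Function.update α₁ h₂ true
  Γ.localMap n h₃ α₂ (Γ.bubbledState ν') ∘ₗ Γ.localMap n h₂ α₁ α₂ ∘ₗ Γ.localMap n h₁ α α₁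

/-- The number of `1`-smoothings in a vertex state. -/
def weight (ν : V → Bool) : ℕ := (Finset.univ.filter fun v => ν v = true).card

/-- The signed component of the filtered differential from the vertex state `ν` to `ν'`; it is
zero unless `ν'` arises from `ν` by changing one vertex from a `0`- to a `1`-smoothing. The sign
is `-1` to the number of `1`-smoothed vertices before that vertex. -/
def edgeMap (Γ : G.OrientedRibbonGraph) (L : G.Labelling) (n : ℕ) (ν ν' : V → Bool) :
    Γ.StateSpace n ν →ₗ[ℂ] Γ.StateSpace n ν' :=
  ∑ v, if ν v = false ∧ ν' = Function.update ν v true then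
    ((-1 : ℂ) ^ (Finset.univ.filter fun u => ν u = true ∧ L.vertex u < L.vertex v).card) •
      Γ.vertexMap L n v ν ν'
  else 0

/-- The `i`-th chain space, the direct sum of the state spaces over the states of weight `i`. -/
abbrev Chain (Γ : G.OrientedRibbonGraph) (n i : ℕ) : Type _ :=
  ∀ ν : {ν : V → Bool // weight ν = i}, Γ.StateSpace n ν.1

/-- The filtered differential. -/
def differential (Γ : G.OrientedRibbonGraph) (L : G.Labelling) (n i : ℕ) :
    Γ.Chain n i →ₗ[ℂ] Γ.Chain n (i + 1) :=
  LinearMap.pi fun ν' => ∑ ν : {ν : V → Bool // weight ν = i},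
    Γ.edgeMap L n ν.1 ν'.1 ∘ₗ LinearMap.proj ν

/-- The image of the incoming differential. -/
def boundaries (Γ : G.OrientedRibbonGraph) (L : G.Labelling) (n : ℕ) :
    (i : ℕ) → Submodule ℂ (Γ.Chain n i)
  | 0 => ⊥
  | i + 1 => LinearMap.range (Γ.differential L n i)

/-- The filtered `n`-color vertex homology in degree `i`: kernel modulo image (the differential
squares to zero, so the image lies in the kernel). -/
abbrev FilteredHomology (Γ : G.OrientedRibbonGraph) (L : G.Labelling) (n i : ℕ) : Type _ :=
  LinearMap.ker (Γ.differential L n i) ⧸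
    (Γ.boundaries L n i).submoduleOf (LinearMap.ker (Γ.differential L n i))

/-- The harmonic mixtures of a vertex state: the common kernel of the sum of the outgoing
differentials and the sum of the adjoints of the incoming ones. -/
def harmonic (Γ : G.OrientedRibbonGraph) (L : G.Labelling) (n : ℕ) [NeZero n] (ν : V → Bool) :
    Submodule ℂ (Γ.StateSpace n ν) :=
  LinearMap.ker (LinearMap.pi fun ν' => Γ.edgeMap L n ν ν') ⊓
    LinearMap.ker (LinearMap.pi fun ν' => colorAdjoint n (Γ.edgeMap L n ν' ν))

/-- The two-variable total matching polynomial of a ribbon graph, as a polynomial in the second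
variable for each `n`. -/
def totalMatchingPoly (Γ : G.OrientedRibbonGraph) (L : G.Labelling) (n : ℕ) [NeZero n] :
    Polynomial ℕ :=
  ∑ ν : V → Bool, Polynomial.C (Module.finrank ℂ (Γ.harmonic L n ν)) * Polynomial.X ^ weight ν

/-- The total matching polynomial of a ribbon graph, evaluated at `n`. -/
def totalMatching (Γ : G.OrientedRibbonGraph) (L : G.Labelling) (n : ℕ) [NeZero n] : ℕ :=
  (Γ.totalMatchingPoly L n).eval 1

end Multigraph.OrientedRibbonGraph

open scoped Classical in
/-- The total matching polynomial of a trivalent graph, evaluated at `n`: that of any of its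
oriented ribbon graphs (every trivalent graph has one, and all of them give the same value). -/
def Multigraph.totalMatching {V E : Type*} [Fintype V] [DecidableEq V] [Fintype E] [DecidableEq E]
    (G : Multigraph V E) (n : ℕ) [NeZero n] : ℕ :=
  if h : Nonempty (G.OrientedRibbonGraph × G.Labelling) then
    (Classical.choice h).1.totalMatching (Classical.choice h).2 n
  else 0

end

/-! For `n = 2` the color basis diagonalizes everything. A color on each circle of a state is the
same as a `Fin 2`-valued function `f` on the points that is constant along the arcs of that state,
so the color bases of all states are indexed by subsets of one common set of functions. Call `f`
balanced at a half-edge if its two strands have the same color there, and balanced at a vertex if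
this holds at all its half-edges. Crossing two strands of the same color is invisible to `f`. After
dividing by `±√2` per circle, merging, splitting and the one-circle map all act in the same way: the
coordinate at `f` is multiplied by a nonzero scalar if `f` is balanced at the half-edge, and killed
otherwise (`coord_localMap`, `coord_vertexMap`).

Hence the complex splits into one piece for each `f`, a cube complex in which exactly the vertices
where `f` is balanced can be flipped. If there is such a vertex, the piece is acyclic
(`cubeDifferential_cubeHomotopy`) and contributes no harmonic vectors. If there is none, the
differential vanishes on the piece and everything survives. So the harmonic space of a state has as
dimension the number of its colorings that are balanced at no vertex (`finrank_harmonic`), and the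
homology is nonzero exactly when some state has such a coloring
(`finrank_filteredHomology_pos_iff`).

At a trivalent vertex the three corners have two colors available. If they are not all equal,
exactly one half-edge separates corners of equal color. Balance is preserved along bands, so these
half-edges form a perfect matching (`exists_isPerfectMatching`). Conversely, a perfect matching
leaves disjoint cycles; orienting each of them and giving color 1 to the strand on one side of it
yields an unbalanced coloring of a suitable state (`exists_unbalancedColorings_nonempty`).

Reversing the cyclic order at a vertex has the same effect on arcs as flipping the smoothing there,
so the total count over all states depends only on the graph. -/

noncomputable section

/-! ### Circles of a state and the effect of one crossing -/

namespace Multigraph.OrientedRibbonGraph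

variable {V E : Type*} {G : Multigraph V E}

/-- A function on points that is constant along the arcs, hence on the circles, of a state. -/
def Compatible (Γ : G.OrientedRibbonGraph) (α : E × Bool → Bool) {X : Type*}
    (f : (E × Bool) × Bool → X) : Prop :=
  ∀ p q, Γ.Arc α p q → f p = f q

/-- The smoothing of `h` only decides which side of `h` a corner arc reaches, and `f` cannot see
this when both sides have the same value. -/
theorem Compatible.congr {Γ : G.OrientedRibbonGraph} {α β : E × Bool → Bool} {X : Type*}
    {f : (E × Bool) × Bool → X} (hf : Γ.Compatible α f)
    (hαβ : ∀ h, f (h, false) = f (h, true) ∨ β h = α h) : Γ.Compatible β f := by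
  have key : ∀ h s, f (h, xor s (β h)) = f (h, xor s (α h)) := by
    intro h s
    rcases hαβ h with e | e
    · cases s <;> cases β h <;> cases α h <;> simp [e]
    · rw [e]
  rintro _ _ (⟨h⟩ | ⟨e, b, s⟩)
  · rw [key, key]
    exact hf _ _ (.corner h)
  · exact hf _ _ (.band e b s)

theorem compatible_circle (Γ : G.OrientedRibbonGraph) (α : E × Bool → Bool) :
    Γ.Compatible α (Γ.circle α) :=
  fun _ _ h => Quot.sound h

theorem Compatible.eq_of_circle_eq {Γ : G.OrientedRibbonGraph} {α : E × Bool → Bool} {X : Type*}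
    {f : (E × Bool) × Bool → X} (hf : Γ.Compatible α f) {p q : (E × Bool) × Bool}
    (h : Γ.circle α p = Γ.circle α q) : f p = f q :=
  congrArg (Quot.lift f hf) h

/-- The other end of the corner arc at a point. -/
def cornerSwap (Γ : G.OrientedRibbonGraph) (α : E × Bool → Bool) (p : (E × Bool) × Bool) :
    (E × Bool) × Bool :=
  if p.2 = α p.1 then (Γ.rot.symm p.1, !α (Γ.rot.symm p.1)) else (Γ.rot p.1, α (Γ.rot p.1))

theorem circle_cornerSwap (Γ : G.OrientedRibbonGraph) (α : E × Bool → Bool)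
    (p : (E × Bool) × Bool) : Γ.circle α (Γ.cornerSwap α p) = Γ.circle α p := by
  obtain ⟨h, s⟩ := p
  unfold cornerSwap
  split_ifs with hs
  · have := Γ.compatible_circle α _ _ (.corner (Γ.rot.symm h))
    simp only at hs
    subst hs
    simpa using this
  · have := Γ.compatible_circle α _ _ (.corner h)
    have hs' : s = !α h := Bool.eq_not.2 hs
    subst hs'
    simpa using this.symm

theorem cornerSwap_involutive (Γ : G.OrientedRibbonGraph) (α : E × Bool → Bool) :
    Function.Involutive (Γ.cornerSwap α) := by
  rintro ⟨h, s⟩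
  unfold cornerSwap
  by_cases hs : s = α h
  · simp [hs]
  · have hs' : s = !α h := by simpa [Bool.eq_not] using hs
    simp [hs']

theorem cornerSwap_ne (Γ : G.OrientedRibbonGraph) (α : E × Bool → Bool)
    (p : (E × Bool) × Bool) : Γ.cornerSwap α p ≠ p := by
  obtain ⟨h, s⟩ := p
  unfold cornerSwap
  split_ifs with hs
  · simp only at hs
    subst hs
    intro H
    rw [Prod.mk.injEq] at H
    obtain ⟨h1, h2⟩ := H
    rw [h1] at h2
    simp at h2
  · intro H
    rw [Prod.mk.injEq] at H
    obtain ⟨h1, h2⟩ := H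
    rw [h1] at h2
    exact hs h2.symm

/-- The smoothing at the start of a corner decides to which neighbor the corner leads; the smoothing
at the neighbor affects only the side on which it ends. -/
theorem cornerSwap_fst_congr (Γ : G.OrientedRibbonGraph) {α β : E × Bool → Bool}
    {p : (E × Bool) × Bool} (hp : β p.1 = α p.1) :
    (Γ.cornerSwap β p).1 = (Γ.cornerSwap α p).1 := by
  unfold cornerSwap
  rw [hp]
  split_ifs <;> rfl

theorem cornerSwap_snd_congr (Γ : G.OrientedRibbonGraph) {α β : E × Bool → Bool}
    {p : (E × Bool) × Bool} (hp : β p.1 = α p.1) :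
    ((Γ.cornerSwap β p).2 = (Γ.cornerSwap α p).2 ↔
      β (Γ.cornerSwap α p).1 = α (Γ.cornerSwap α p).1) := by
  unfold cornerSwap
  rw [hp]
  split_ifs <;> simp

/-- The other end of the band arc at a point. -/
def bandSwap (p : (E × Bool) × Bool) : (E × Bool) × Bool := ((p.1.1, !p.1.2), !p.2)

theorem circle_bandSwap (Γ : G.OrientedRibbonGraph) (α : E × Bool → Bool)
    (p : (E × Bool) × Bool) : Γ.circle α (bandSwap p) = Γ.circle α p :=
  (Γ.compatible_circle α _ _ (.band p.1.1 p.1.2 p.2)).symm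

/-- Changing the smoothing of one half-edge with two distinct circles merges them: the common
points of two circles through one of the strands would be paired by the band arcs, and paired by
the corner arcs except for a single point. -/
theorem circle_eq_or_circle_eq [Finite E] (Γ : G.OrientedRibbonGraph) {h : E × Bool}
    {α β : E × Bool → Bool} (hh : β h ≠ α h) (hαβ : ∀ h' ≠ h, β h' = α h') :
    Γ.circle α (h, false) = Γ.circle α (h, true) ∨
      Γ.circle β (h, false) = Γ.circle β (h, true) := by
  classical
  have := Fintype.ofFinite E
  by_contra! H
  obtain ⟨hα, hβ⟩ := H
  set S : Finset ((E × Bool) × Bool) := Finset.univ.filter fun p =>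
    Γ.circle α p = Γ.circle α (h, false) ∧ Γ.circle β p = Γ.circle β (h, false) with hS
  have hmem : ∀ p, p ∈ S ↔
      Γ.circle α p = Γ.circle α (h, false) ∧ Γ.circle β p = Γ.circle β (h, false) := by
    intro p; simp [hS]
  have h1 : ∑ p ∈ S, (1 : ZMod 2) = 0 := by
    refine Finset.sum_involution (fun p _ => bandSwap p) (fun _ _ => by decide) ?_ ?_ ?_
    · rintro ⟨⟨e, b⟩, s⟩ _ _
      simp [bandSwap]
    · intro p hp
      rw [hmem] at hp ⊢
      rwa [circle_bandSwap, circle_bandSwap]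
    · rintro ⟨⟨e, b⟩, s⟩ _
      simp [bandSwap]
  have h0 : (h, false) ∈ S := by rw [hmem]; exact ⟨rfl, rfl⟩
  have h2 : ∑ p ∈ S.erase (h, false), (1 : ZMod 2) = 0 := by
    -- A corner ending at `h` ends on opposite sides in `α` and `β`, so in one of the two states it
    -- would put `p` on the circle through `(h, true)`, which is excluded. Away from `h` the corners
    -- of the two states coincide.
    have good : ∀ p ∈ S.erase (h, false), p.1 ≠ h ∧ (Γ.cornerSwap α p).1 ≠ h := by
      intro p hp
      rw [Finset.mem_erase, hmem] at hp
      obtain ⟨hp0, hpα, hpβ⟩ := hp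
      have hph : p.1 ≠ h := by
        obtain ⟨h', s⟩ := p
        rintro rfl
        cases s
        · exact hp0 rfl
        · exact hα hpα.symm
      refine ⟨hph, fun hc => ?_⟩
      have e1 := Γ.cornerSwap_fst_congr (hαβ _ hph)
      have e2 := Γ.cornerSwap_snd_congr (hαβ _ hph)
      rw [hc] at e1 e2
      have c1 := Γ.circle_cornerSwap α p
      have c2 := Γ.circle_cornerSwap β p
      rw [← Prod.mk.eta (p := Γ.cornerSwap α p), hc] at c1
      rw [← Prod.mk.eta (p := Γ.cornerSwap β p), e1] at c2
      rcases hs : (Γ.cornerSwap α p).2 with _ | _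
      · rcases hs' : (Γ.cornerSwap β p).2 with _ | _
        · rw [hs, hs'] at e2
          exact hh (e2.1 rfl)
        · rw [hs'] at c2
          exact hβ (hpβ.symm.trans c2.symm)
      · rw [hs] at c1
        exact hα (hpα.symm.trans c1.symm)
    refine Finset.sum_involution (fun p _ => Γ.cornerSwap α p) (fun _ _ => by decide) ?_ ?_ ?_
    · exact fun p _ _ => Γ.cornerSwap_ne α p
    · intro p hp
      obtain ⟨g1, g2⟩ := good p hp
      rw [Finset.mem_erase, hmem] at hp ⊢
      refine ⟨fun hc => g2 (by rw [hc]), ?_, ?_⟩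
      · rw [circle_cornerSwap]; exact hp.2.1
      · have : Γ.cornerSwap α p = Γ.cornerSwap β p :=
          Prod.ext (Γ.cornerSwap_fst_congr (hαβ _ g1)).symm
            ((Γ.cornerSwap_snd_congr (hαβ _ g1)).2 (hαβ _ g2)).symm
        rw [this, circle_cornerSwap]
        exact hp.2.2
    · exact fun p _ => Γ.cornerSwap_involutive α p
  rw [← Finset.add_sum_erase S _ h0, h2] at h1
  exact absurd h1 (by decide)

/-- Circles that avoid a half-edge do not change with its smoothing. -/
theorem circle_eq_of_circle_eq (Γ : G.OrientedRibbonGraph) {h : E × Bool}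
    {α β : E × Bool → Bool} (hαβ : ∀ h' ≠ h, β h' = α h') {p q : (E × Bool) × Bool}
    (hp : Γ.circle α p ≠ Γ.circle α (h, false)) (hp' : Γ.circle α p ≠ Γ.circle α (h, true))
    (hpq : Γ.circle β p = Γ.circle β q) : Γ.circle α p = Γ.circle α q := by
  classical
  -- All circles through `h` get the common label `none`, so this labelling has equal values on the
  -- two sides of `h` and survives the change of smoothing.
  let g : (E × Bool) × Bool → Option (Γ.Circle α) := fun p =>
    if Γ.circle α p = Γ.circle α (h, false) ∨ Γ.circle α p = Γ.circle α (h, true) then none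
    else some (Γ.circle α p)
  have hg : Γ.Compatible α g := by
    intro p q hpq
    have := Γ.compatible_circle α p q hpq
    simp only [g, this]
  have hg' : Γ.Compatible β g := by
    refine hg.congr fun h' => ?_
    by_cases hh : h' = h
    · subst hh
      left
      simp [g]
    · exact Or.inr (hαβ h' hh)
  have := hg'.eq_of_circle_eq hpq
  simp only [g, hp, hp', or_self, if_false] at this
  split_ifs at this
  exact Option.some_injective _ this

theorem circle_ne_of_circle_ne (Γ : G.OrientedRibbonGraph) {h : E × Bool}
    {α β : E × Bool → Bool} (hαβ : ∀ h' ≠ h, β h' = α h') {p : (E × Bool) × Bool}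
    (hp : Γ.circle α p ≠ Γ.circle α (h, false)) (hp' : Γ.circle α p ≠ Γ.circle α (h, true)) :
    Γ.circle β p ≠ Γ.circle β (h, false) ∧ Γ.circle β p ≠ Γ.circle β (h, true) :=
  ⟨fun e => hp (Γ.circle_eq_of_circle_eq hαβ hp hp' e),
    fun e => hp' (Γ.circle_eq_of_circle_eq hαβ hp hp' e)⟩

/-- Products over the circles that avoid a half-edge do not depend on its smoothing. -/
theorem prod_circle_avoiding [Finite E] (Γ : G.OrientedRibbonGraph) {h : E × Bool}
    {α β : E × Bool → Bool} (hαβ : ∀ h' ≠ h, β h' = α h') {R : Type*} [CommMonoid R]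
    (g : Γ.Circle α → R) (g' : Γ.Circle β → R)
    (hg : ∀ p, Γ.circle α p ≠ Γ.circle α (h, false) → Γ.circle α p ≠ Γ.circle α (h, true) →
      g (Γ.circle α p) = g' (Γ.circle β p)) :
    ∏ c ∈ (Finset.univ.erase (Γ.circle α (h, false))).erase (Γ.circle α (h, true)), g c =
      ∏ c ∈ (Finset.univ.erase (Γ.circle β (h, false))).erase (Γ.circle β (h, true)), g' c := by
  have hβα : ∀ h' ≠ h, α h' = β h' := fun h' hh => (hαβ h' hh).symm
  have hout : ∀ γ (c : Γ.Circle γ), Γ.circle γ (Quot.out c) = c := fun γ c => Quot.out_eq c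
  -- A circle avoiding `h` has the same points in both states, so passing through a representative
  -- matches the circles in both directions.
  have key : ∀ (γ δ : E × Bool → Bool), (∀ h' ≠ h, δ h' = γ h') →
      ∀ c ∈ (Finset.univ.erase (Γ.circle γ (h, false))).erase (Γ.circle γ (h, true)),
      Γ.circle δ (Quot.out c) ∈
        (Finset.univ.erase (Γ.circle δ (h, false))).erase (Γ.circle δ (h, true)) ∧
      Γ.circle γ (Quot.out (Γ.circle δ (Quot.out c))) = c := by
    intro γ δ hγδ c hc
    have hδγ : ∀ h' ≠ h, γ h' = δ h' := fun h' hh => (hγδ h' hh).symm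
    simp only [Finset.mem_erase, Finset.mem_univ, and_true] at hc ⊢
    rw [← hout γ c] at hc
    obtain ⟨h1, h2⟩ := Γ.circle_ne_of_circle_ne hγδ hc.2 hc.1
    refine ⟨⟨h2, h1⟩, ?_⟩
    have := Γ.circle_eq_of_circle_eq hγδ hc.2 hc.1
      (q := Quot.out (Γ.circle δ (Quot.out c))) (hout δ _).symm
    rw [← this, hout]
  refine Finset.prod_bij' (fun c _ => Γ.circle β (Quot.out c)) (fun c _ => Γ.circle α (Quot.out c))
    (fun c hc => (key α β hαβ c hc).1) (fun c hc => (key β α hβα c hc).1)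
    (fun c hc => (key α β hαβ c hc).2) (fun c hc => (key β α hβα c hc).2) ?_
  intro c hc
  simp only [Finset.mem_erase, Finset.mem_univ, and_true] at hc
  rw [← hout α c] at hc
  rw [← hg _ hc.2 hc.1, hout]

end Multigraph.OrientedRibbonGraph

/-! ### The local maps in the rescaled color basis -/

/-- The scalar by which changing the smoothing of a half-edge with both strands of color `i` acts,
in suitably rescaled color bases for `n = 2`. -/
def crossingScalar (i : Fin 2) : ℂ :=
  if i = 0 then (Real.sqrt (2 : ℕ) : ℂ) else -(Real.sqrt (2 : ℕ) : ℂ)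

/-- The contribution of a circle to the coordinates in the rescaled color basis. -/
def dualFactor (i x : Fin 2) : ℂ :=
  (crossingScalar i)⁻¹ * (-1) ^ ((i : ℕ) * (x : ℕ))

theorem sqrt_two_mul_self : (Real.sqrt (2 : ℕ) : ℂ) * (Real.sqrt (2 : ℕ) : ℂ) = 2 := by
  rw [← Complex.ofReal_mul, Real.mul_self_sqrt (by positivity)]
  simp

theorem sqrt_two_ne_zero : (Real.sqrt (2 : ℕ) : ℂ) ≠ 0 := by
  intro h
  have := sqrt_two_mul_self
  rw [h] at this
  norm_num at this

theorem crossingScalar_ne_zero (i : Fin 2) : crossingScalar i ≠ 0 := by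
  unfold crossingScalar
  split_ifs
  · exact sqrt_two_ne_zero
  · exact neg_ne_zero.2 sqrt_two_ne_zero

theorem sqrt_two_inv : (Real.sqrt (2 : ℕ) : ℂ)⁻¹ = (Real.sqrt (2 : ℕ) : ℂ) / 2 := by
  rw [inv_eq_iff_eq_inv, inv_div, eq_div_iff sqrt_two_ne_zero, sqrt_two_mul_self]

/-- Let `s = ±√2` be the crossing scalar. In unscaled color coordinates multiplication acts by `1`,
comultiplication by `2 = s²`, and the one-circle map by `s`. A factor `s⁻¹` per circle makes all
three equal to `s`. -/
theorem sum_mulCoeff_mul_dualFactor (i x y : Fin 2) :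
    ∑ t, mulCoeff 2 x y t * dualFactor i t =
      crossingScalar i * (dualFactor i x * dualFactor i y) := by
  have h := sqrt_two_mul_self
  unfold mulCoeff dualFactor crossingScalar
  generalize hr : (Real.sqrt (2 : ℕ) : ℂ) = r at *
  have hi : r⁻¹ = r / 2 := hr ▸ sqrt_two_inv
  have h3 : r * (r / 2 * (r / 2)) = r / 2 := by linear_combination (r / 4) * h
  fin_cases i <;> fin_cases x <;> fin_cases y <;>
    simp [inv_neg, hi, h3]

/-- Comultiplication of a color is a multiple of its tensor square, so mixed colors give zero. -/
theorem sum_comulCoeff_mul_dualFactor (i j x : Fin 2) :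
    ∑ t, ∑ u, comulCoeff 2 x t u * (dualFactor i t * dualFactor j u) =
      if i = j then crossingScalar i * dualFactor i x else 0 := by
  have h := sqrt_two_mul_self
  unfold comulCoeff dualFactor crossingScalar
  generalize hr : (Real.sqrt (2 : ℕ) : ℂ) = r at *
  have hi : r⁻¹ = r / 2 := hr ▸ sqrt_two_inv
  have h3 : r / 2 * (r / 2) = 1 / 2 := by linear_combination (1 / 4) * h
  have h4 : r * (r / 2) = 1 := by linear_combination (1 / 2) * h
  fin_cases i <;> fin_cases j <;> fin_cases x <;>
    simp [Fin.sum_univ_two, inv_neg, hi, h3, h4] <;> norm_num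

theorem sum_etaCoeff_mul_dualFactor (i x : Fin 2) :
    ∑ t, etaCoeff 2 x t * dualFactor i t = crossingScalar i * dualFactor i x := by
  have h := sqrt_two_ne_zero
  rw [Fin.sum_univ_two]
  unfold etaCoeff dualFactor crossingScalar
  generalize (Real.sqrt (2 : ℕ) : ℂ) = r at *
  fin_cases i <;> fin_cases x <;>
    simp [inv_neg, h]

/-- A local coefficient vanishes unless the two monomials agree on the circles avoiding the
half-edge. This lemma and the next reduce the sum over all output monomials to the exponents on the
one or two remaining circles. -/
theorem sum_ite_eq_off_one {ι X M : Type*} [Fintype ι] [DecidableEq ι] [Fintype X]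
    [AddCommMonoid M] (c₀ : ι) (a : ι → X) (F : (ι → X) → M)
    [∀ b : ι → X, Decidable (∀ c, c ≠ c₀ → b c = a c)] :
    ∑ b : ι → X, (if ∀ c, c ≠ c₀ → b c = a c then F b else 0) =
      ∑ t, F (Function.update a c₀ t) := by
  rw [← Finset.sum_filter]
  refine Finset.sum_bij' (fun b _ => b c₀) (fun t _ => Function.update a c₀ t) ?_ ?_ ?_ ?_ ?_
  · simp
  · intro t _
    simp only [Finset.mem_filter, Finset.mem_univ, true_and]
    intro c hc
    simp [hc]
  · intro b hb
    simp only [Finset.mem_filter, Finset.mem_univ, true_and] at hb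
    funext c
    by_cases hc : c = c₀
    · subst hc; simp
    · simp [hc, hb c hc]
  · simp
  · intro b hb
    simp only [Finset.mem_filter, Finset.mem_univ, true_and] at hb
    congr 1
    funext c
    by_cases hc : c = c₀
    · subst hc; simp
    · simp [hc, hb c hc]

theorem sum_ite_eq_off_two {ι X M : Type*} [Fintype ι] [DecidableEq ι] [Fintype X]
    [AddCommMonoid M] {c₀ c₁ : ι} (h01 : c₀ ≠ c₁) (a : ι → X) (F : (ι → X) → M)
    [∀ b : ι → X, Decidable (∀ c, c ≠ c₀ → c ≠ c₁ → b c = a c)] :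
    ∑ b : ι → X, (if ∀ c, c ≠ c₀ → c ≠ c₁ → b c = a c then F b else 0) =
      ∑ t, ∑ u, F (Function.update (Function.update a c₀ t) c₁ u) := by
  have hupd : ∀ b : ι → X, (∀ c, c ≠ c₀ → c ≠ c₁ → b c = a c) →
      Function.update (Function.update a c₀ (b c₀)) c₁ (b c₁) = b := by
    intro b hb
    funext c
    by_cases hc : c = c₁
    · subst hc; simp
    · by_cases hc' : c = c₀
      · subst hc'; simp [hc]
      · simp [hc, hc', hb c hc' hc]
  rw [← Finset.sum_filter, ← Finset.sum_product']
  refine Finset.sum_bij' (fun b _ => (b c₀, b c₁))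
    (fun t _ => Function.update (Function.update a c₀ t.1) c₁ t.2) ?_ ?_ ?_ ?_ ?_
  · simp
  · intro t _
    simp only [Finset.mem_filter, Finset.mem_univ, true_and]
    intro c hc hc'
    simp [hc, hc']
  · intro b hb
    simp only [Finset.mem_filter, Finset.mem_univ, true_and] at hb
    exact hupd b hb
  · intro t _
    simp [h01]
  · intro b hb
    simp only [Finset.mem_filter, Finset.mem_univ, true_and] at hb
    simp only [hupd b hb]

/-- Erasing twice, even when the two circles coincide, keeps the remaining product in the same form
for one or two circles. -/
theorem prod_eq_of_eq {ι M : Type*} [Fintype ι] [DecidableEq ι] [CommMonoid M] {c₀ c₁ : ι}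
    (h : c₀ = c₁) (g : ι → M) :
    ∏ c, g c = g c₀ * ∏ c ∈ (Finset.univ.erase c₀).erase c₁, g c := by
  subst h
  rw [Finset.erase_idem, Finset.mul_prod_erase _ _ (Finset.mem_univ _)]

theorem prod_eq_of_ne {ι M : Type*} [Fintype ι] [DecidableEq ι] [CommMonoid M] {c₀ c₁ : ι}
    (h : c₀ ≠ c₁) (g : ι → M) :
    ∏ c, g c = g c₀ * (g c₁ * ∏ c ∈ (Finset.univ.erase c₀).erase c₁, g c) := by
  rw [Finset.mul_prod_erase _ _ (Finset.mem_erase.2 ⟨h.symm, Finset.mem_univ _⟩),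
    Finset.mul_prod_erase _ _ (Finset.mem_univ _)]

theorem prod_update_of_eq {ι X M : Type*} [Fintype ι] [DecidableEq ι] [CommMonoid M] {c₀ c₁ : ι}
    (h : c₀ = c₁) (g : ι → X → M) (a : ι → X) (t : X) :
    ∏ c, g c (Function.update a c₀ t c) =
      g c₀ t * ∏ c ∈ (Finset.univ.erase c₀).erase c₁, g c (a c) := by
  rw [prod_eq_of_eq h]
  congr 1
  · simp
  · refine Finset.prod_congr rfl fun c hc => ?_
    rw [Finset.mem_erase, Finset.mem_erase] at hc
    rw [Function.update_of_ne hc.2.1]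

theorem prod_update_of_ne {ι X M : Type*} [Fintype ι] [DecidableEq ι] [CommMonoid M] {c₀ c₁ : ι}
    (h : c₀ ≠ c₁) (g : ι → X → M) (a : ι → X) (t u : X) :
    ∏ c, g c (Function.update (Function.update a c₀ t) c₁ u c) =
      g c₀ t * (g c₁ u * ∏ c ∈ (Finset.univ.erase c₀).erase c₁, g c (a c)) := by
  rw [prod_eq_of_ne h]
  congr 1
  · simp [h]
  congr 1
  · simp
  · refine Finset.prod_congr rfl fun c hc => ?_
    rw [Finset.mem_erase, Finset.mem_erase] at hc
    rw [Function.update_of_ne hc.1, Function.update_of_ne hc.2.1]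

namespace Multigraph.OrientedRibbonGraph

variable {V E : Type*} {G : Multigraph V E}

/-- The color of each circle, for a coloring of the points that is compatible with the state. -/
def colorOfCircle {Γ : G.OrientedRibbonGraph} {α : E × Bool → Bool} {X : Type*}
    {f : (E × Bool) × Bool → X} (hf : Γ.Compatible α f) : Γ.Circle α → X :=
  Quot.lift f hf

theorem colorOfCircle_circle {Γ : G.OrientedRibbonGraph} {α : E × Bool → Bool} {X : Type*}
    {f : (E × Bool) × Bool → X} (hf : Γ.Compatible α f) (p : (E × Bool) × Bool) :
    colorOfCircle hf (Γ.circle α p) = f p :=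
  rfl

/-- The condition on points is turned into one on the circles of `β`, the form required for summing
over `b`. -/
theorem localCoeff_condition_iff (Γ : G.OrientedRibbonGraph) {h : E × Bool}
    {α β : E × Bool → Bool} (hαβ : ∀ h' ≠ h, β h' = α h') (a : Γ.Circle α → Fin 2)
    (b : Γ.Circle β → Fin 2) :
    (∀ p, Γ.circle α p ≠ Γ.circle α (h, false) → Γ.circle α p ≠ Γ.circle α (h, true) →
      a (Γ.circle α p) = b (Γ.circle β p)) ↔
    ∀ c, c ≠ Γ.circle β (h, false) → c ≠ Γ.circle β (h, true) →
      b c = a (Γ.circle α (Quot.out c)) := by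
  have hβα : ∀ h' ≠ h, α h' = β h' := fun h' hh => (hαβ h' hh).symm
  have hout : ∀ c : Γ.Circle β, Γ.circle β (Quot.out c) = c := fun c => Quot.out_eq c
  constructor
  · intro H c hc hc'
    have := hout c
    rw [← this] at hc hc'
    obtain ⟨h1, h2⟩ := Γ.circle_ne_of_circle_ne hβα hc hc'
    rw [H _ h1 h2, this]
  · intro H p hp hp'
    obtain ⟨h1, h2⟩ := Γ.circle_ne_of_circle_ne hαβ hp hp'
    rw [H _ h1 h2]
    congr 1
    exact Γ.circle_eq_of_circle_eq hαβ hp hp' (hout _).symm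

theorem sum_localCoeff_mul_of_eq [Finite E] (Γ : G.OrientedRibbonGraph) {h : E × Bool}
    {α β : E × Bool → Bool} (hαβ : ∀ h' ≠ h, β h' = α h')
    (hβ : Γ.circle β (h, false) = Γ.circle β (h, true)) (a : Γ.Circle α → Fin 2)
    (g : Γ.Circle β → Fin 2 → ℂ) :
    ∑ b, Γ.localCoeff 2 h α β a b * ∏ c, g c (b c) =
      (∑ t, (if Γ.circle α (h, false) ≠ Γ.circle α (h, true) then
          mulCoeff 2 (a (Γ.circle α (h, false))) (a (Γ.circle α (h, true))) t
        else etaCoeff 2 (a (Γ.circle α (h, false))) t) * g (Γ.circle β (h, false)) t) *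
      ∏ c ∈ (Finset.univ.erase (Γ.circle β (h, false))).erase (Γ.circle β (h, true)),
        g c (a (Γ.circle α (Quot.out c))) := by
  classical
  have := sum_ite_eq_off_one (Γ.circle β (h, false)) (fun c => a (Γ.circle α (Quot.out c)))
    (fun b => (if Γ.circle α (h, false) ≠ Γ.circle α (h, true) then
          mulCoeff 2 (a (Γ.circle α (h, false))) (a (Γ.circle α (h, true)))
            (b (Γ.circle β (h, false)))
        else etaCoeff 2 (a (Γ.circle α (h, false))) (b (Γ.circle β (h, false)))) *
          ∏ c, g c (b c))
  simp only [prod_update_of_eq hβ, Function.update_self, Finset.sum_mul, mul_assoc] at this ⊢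
  rw [← this]
  refine Finset.sum_congr rfl fun b _ => ?_
  simp only [localCoeff, Γ.localCoeff_condition_iff hαβ a, ite_mul, zero_mul]
  split_ifs <;> simp_all

theorem sum_localCoeff_mul_of_ne [Finite E] (Γ : G.OrientedRibbonGraph) {h : E × Bool}
    {α β : E × Bool → Bool} (hαβ : ∀ h' ≠ h, β h' = α h')
    (hα : Γ.circle α (h, false) = Γ.circle α (h, true))
    (hβ : Γ.circle β (h, false) ≠ Γ.circle β (h, true)) (a : Γ.Circle α → Fin 2)
    (g : Γ.Circle β → Fin 2 → ℂ) :
    ∑ b, Γ.localCoeff 2 h α β a b * ∏ c, g c (b c) =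
      (∑ t, ∑ u, comulCoeff 2 (a (Γ.circle α (h, false))) t u *
        (g (Γ.circle β (h, false)) t * g (Γ.circle β (h, true)) u)) *
      ∏ c ∈ (Finset.univ.erase (Γ.circle β (h, false))).erase (Γ.circle β (h, true)),
        g c (a (Γ.circle α (Quot.out c))) := by
  classical
  have := sum_ite_eq_off_two hβ (fun c => a (Γ.circle α (Quot.out c)))
    (fun b => comulCoeff 2 (a (Γ.circle α (h, false))) (b (Γ.circle β (h, false)))
            (b (Γ.circle β (h, true))) * ∏ c, g c (b c))
  simp only [prod_update_of_ne hβ, Function.update_self, Function.update_of_ne hβ, Finset.sum_mul,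
    mul_assoc] at this ⊢
  rw [← this]
  refine Finset.sum_congr rfl fun b _ => ?_
  simp only [localCoeff, Γ.localCoeff_condition_iff hαβ a, ite_mul, zero_mul]
  split_ifs <;> simp_all

/-- The core of the diagonalization: the coordinate functional of `f` on `β`, pulled back along the
local map, is a multiple of that on `α`. The circles avoiding `h` contribute equally on both sides,
and the cases of one or two circles through `h` are the three identities above; two circles in both
states cannot occur. -/
theorem sum_localCoeff [Finite E] (Γ : G.OrientedRibbonGraph) {h : E × Bool}
    {α β : E × Bool → Bool} (hh : β h ≠ α h) (hαβ : ∀ h' ≠ h, β h' = α h')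
    {f : (E × Bool) × Bool → Fin 2} (hfα : Γ.Compatible α f) (hfβ : Γ.Compatible β f)
    (hf : f (h, false) = f (h, true)) (a : Γ.Circle α → Fin 2) :
    ∑ b, Γ.localCoeff 2 h α β a b * ∏ c, dualFactor (colorOfCircle hfβ c) (b c) =
      crossingScalar (f (h, false)) * ∏ c, dualFactor (colorOfCircle hfα c) (a c) := by
  have rest : ∏ c ∈ (Finset.univ.erase (Γ.circle β (h, false))).erase (Γ.circle β (h, true)),
      dualFactor (colorOfCircle hfβ c) (a (Γ.circle α (Quot.out c))) =
      ∏ c ∈ (Finset.univ.erase (Γ.circle α (h, false))).erase (Γ.circle α (h, true)),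
        dualFactor (colorOfCircle hfα c) (a c) := by
    symm
    refine Γ.prod_circle_avoiding hαβ _ _ fun p hp hp' => ?_
    rw [colorOfCircle_circle, colorOfCircle_circle,
      Γ.circle_eq_of_circle_eq hαβ hp hp' (q := Quot.out (Γ.circle β p)) (Quot.out_eq _).symm]
  by_cases hα : Γ.circle α (h, false) = Γ.circle α (h, true)
  · by_cases hβ : Γ.circle β (h, false) = Γ.circle β (h, true)
    · rw [Γ.sum_localCoeff_mul_of_eq hαβ hβ a, rest]
      simp only [ne_eq, hα, not_true_eq_false, if_false]
      rw [prod_eq_of_eq hα, colorOfCircle_circle, sum_etaCoeff_mul_dualFactor,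
        colorOfCircle_circle, mul_assoc, hα]
    · rw [Γ.sum_localCoeff_mul_of_ne hαβ hα hβ a, rest]
      simp only [colorOfCircle_circle, sum_comulCoeff_mul_dualFactor, if_pos hf]
      rw [prod_eq_of_eq hα, colorOfCircle_circle, mul_assoc]
  · have hβ := (Γ.circle_eq_or_circle_eq hh hαβ).resolve_left hα
    rw [Γ.sum_localCoeff_mul_of_eq hαβ hβ a, rest]
    simp only [ne_eq, hα, not_false_eq_true, if_true]
    rw [prod_eq_of_ne hα, colorOfCircle_circle, sum_mulCoeff_mul_dualFactor,
      colorOfCircle_circle, colorOfCircle_circle, ← hf]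
    ring

/-- Different colors on the strands force two circles through `h` in `β`, hence one in `α`. The
local map is then a comultiplication, which has no mixed component. -/
theorem sum_localCoeff_of_ne [Finite E] (Γ : G.OrientedRibbonGraph) {h : E × Bool}
    {α β : E × Bool → Bool} (hh : β h ≠ α h) (hαβ : ∀ h' ≠ h, β h' = α h')
    {f : (E × Bool) × Bool → Fin 2} (hfβ : Γ.Compatible β f)
    (hf : f (h, false) ≠ f (h, true)) (a : Γ.Circle α → Fin 2) :
    ∑ b, Γ.localCoeff 2 h α β a b * ∏ c, dualFactor (colorOfCircle hfβ c) (b c) = 0 := by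
  have hβ : Γ.circle β (h, false) ≠ Γ.circle β (h, true) :=
    fun e => hf (hfβ.eq_of_circle_eq e)
  have hα := (Γ.circle_eq_or_circle_eq hh hαβ).resolve_right hβ
  rw [Γ.sum_localCoeff_mul_of_ne hαβ hα hβ a]
  simp only [colorOfCircle_circle, sum_comulCoeff_mul_dualFactor, if_neg hf, zero_mul]

end Multigraph.OrientedRibbonGraph

/-! ### The differential in coordinates indexed by colorings of the points -/

namespace Multigraph.OrientedRibbonGraph

variable {V E : Type*} {G : Multigraph V E}

open scoped Classical in
/-- For `n = 2`, the coordinate of a vector at a coloring of the points, in a rescaled color basis.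
It is `0` if the coloring is not compatible with the state. -/
def coord [Finite E] (Γ : G.OrientedRibbonGraph) (α : E × Bool → Bool)
    (f : (E × Bool) × Bool → Fin 2) : TensorPow 2 (Γ.Circle α) →ₗ[ℂ] ℂ :=
  if hf : Γ.Compatible α f then
    ∑ a, (∏ c, dualFactor (colorOfCircle hf c) (a c)) • LinearMap.proj a
  else 0

theorem coord_of_not [Finite E] (Γ : G.OrientedRibbonGraph) {α : E × Bool → Bool}
    {f : (E × Bool) × Bool → Fin 2} (hf : ¬ Γ.Compatible α f) : Γ.coord α f = 0 :=
  dif_neg hf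

theorem coord_apply [Finite E] (Γ : G.OrientedRibbonGraph) {α : E × Bool → Bool}
    {f : (E × Bool) × Bool → Fin 2} (hf : Γ.Compatible α f) (x : TensorPow 2 (Γ.Circle α)) :
    Γ.coord α f x = ∑ a, (∏ c, dualFactor (colorOfCircle hf c) (a c)) * x a := by
  simp [coord, dif_pos hf]

/-- The two strands along a half-edge have the same color. -/
def Balanced (f : (E × Bool) × Bool → Fin 2) (h : E × Bool) : Prop :=
  f (h, false) = f (h, true)

instance (f : (E × Bool) × Bool → Fin 2) : DecidablePred (Balanced f) :=
  fun _ => inferInstanceAs (Decidable (_ = _))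

/-- With the same `f` on both sides the local map is diagonal. If `f` is balanced at `h`, it is
compatible with both states or with neither, so the zero default of `coord` is consistent. -/
theorem coord_localMap [Fintype E] [DecidableEq E] [Fintype V] [DecidableEq V]
    (Γ : G.OrientedRibbonGraph) {h : E × Bool}
    {α β : E × Bool → Bool} (hh : β h ≠ α h) (hαβ : ∀ h' ≠ h, β h' = α h')
    (f : (E × Bool) × Bool → Fin 2) (x : TensorPow 2 (Γ.Circle α)) :
    Γ.coord β f (Γ.localMap 2 h α β x) =
      if Balanced f h then crossingScalar (f (h, false)) * Γ.coord α f x else 0 := by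
  have hor : ∀ h', Balanced f h → (f (h', false) = f (h', true) ∨ β h' = α h') := by
    intro h' hb
    by_cases e : h' = h
    · exact Or.inl (e ▸ hb)
    · exact Or.inr (hαβ h' e)
  by_cases hf : Γ.Compatible β f
  · have : Γ.coord β f (Γ.localMap 2 h α β x) =
        ∑ a, (∑ b, Γ.localCoeff 2 h α β a b * ∏ c, dualFactor (colorOfCircle hf c) (b c)) * x a := by
      rw [coord_apply Γ hf]
      simp only [localMap, Matrix.mulVecLin_apply, Matrix.mulVec, dotProduct, Matrix.of_apply,
        Finset.mul_sum, Finset.sum_mul]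
      rw [Finset.sum_comm]
      refine Finset.sum_congr rfl fun a _ => Finset.sum_congr rfl fun b _ => ?_
      ring
    rw [this]
    split_ifs with hb
    · have hfα : Γ.Compatible α f := hf.congr fun h' => (hor h' hb).imp id Eq.symm
      rw [coord_apply Γ hfα, Finset.mul_sum]
      refine Finset.sum_congr rfl fun a _ => ?_
      rw [Γ.sum_localCoeff hh hαβ hfα hf hb, mul_assoc]
    · exact Finset.sum_eq_zero fun a _ => by rw [Γ.sum_localCoeff_of_ne hh hαβ hf hb, zero_mul]
  · rw [coord_of_not Γ hf, LinearMap.zero_apply]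
    split_ifs with hb
    · have hfα : ¬ Γ.Compatible α f := fun hfα => hf (hfα.congr fun h' => hor h' hb)
      rw [coord_of_not Γ hfα, LinearMap.zero_apply, mul_zero]
    · rfl

/-- The two strands along each half-edge at a vertex have the same color. -/
def BalancedAt (G : Multigraph V E) (f : (E × Bool) × Bool → Fin 2) (v : V) : Prop :=
  ∀ h, G.vert h = v → Balanced f h

instance [Fintype E] [DecidableEq V] (f : (E × Bool) × Bool → Fin 2) :
    DecidablePred (BalancedAt G f) :=
  fun _ => inferInstanceAs (Decidable (∀ _, _ → _))

theorem balancedAt_iff [Fintype V] (L : G.Labelling) (f : (E × Bool) × Bool → Fin 2) (v : V) :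
    BalancedAt G f v ↔ ∀ j, Balanced f (L.halfEdge v j) := by
  constructor
  · exact fun H j => H _ (L.halfEdge v j).2
  · intro H h hv
    have := H ((L.halfEdge v).symm ⟨h, hv⟩)
    rwa [Equiv.apply_symm_apply] at this

/-- The scalar by which the map of a vertex acts in the rescaled color bases. -/
def vertexScalar [Fintype V] (L : G.Labelling) (v : V) (f : (E × Bool) × Bool → Fin 2) : ℂ :=
  ∏ j, crossingScalar (f (L.halfEdge v j, false))

theorem vertexScalar_ne_zero [Fintype V] (L : G.Labelling) (v : V) (f : (E × Bool) × Bool → Fin 2) :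
    vertexScalar L v f ≠ 0 :=
  Finset.prod_ne_zero_iff.2 fun _ _ => crossingScalar_ne_zero _

/-- The sign of the component of the differential that changes the smoothing of `v`. -/
def edgeSign [Fintype V] (L : G.Labelling) (ν : V → Bool) (v : V) : ℂ :=
  (-1) ^ (Finset.univ.filter fun u => ν u = true ∧ L.vertex u < L.vertex v).card

theorem edgeSign_mul_self [Fintype V] (L : G.Labelling) (ν : V → Bool) (v : V) :
    edgeSign L ν v * edgeSign L ν v = 1 := by
  rw [edgeSign, ← pow_add, ← two_mul, pow_mul]
  simp

variable [Fintype V] [DecidableEq V] [Fintype E] [DecidableEq E]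

/-- A coordinate survives the three crossings exactly when `f` is balanced at each of the three
half-edges; the scalars multiply, so their order plays no role. -/
theorem coord_vertexMap (Γ : G.OrientedRibbonGraph) (L : G.Labelling) {v : V} {ν : V → Bool}
    (hv : ν v = false) (f : (E × Bool) × Bool → Fin 2) (x : Γ.StateSpace 2 ν) :
    Γ.coord (Γ.bubbledState (Function.update ν v true)) f
        (Γ.vertexMap L 2 v ν (Function.update ν v true) x) =
      if BalancedAt G f v then vertexScalar L v f * Γ.coord (Γ.bubbledState ν) f x else 0 := by
  have hinj : ∀ i j, i ≠ j → (L.halfEdge v i : E × Bool) ≠ L.halfEdge v j := fun i j hij e =>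
    hij ((L.halfEdge v).injective (Subtype.ext e))
  have h01 := hinj 0 1 (by decide)
  have h02 := hinj 0 2 (by decide)
  have h12 := hinj 1 2 (by decide)
  have hat : ∀ j, Γ.bubbledState ν (L.halfEdge v j) = false := fun j => by
    rw [bubbledState, (L.halfEdge v j).2, hv]
  have hat' : ∀ j, Γ.bubbledState (Function.update ν v true) (L.halfEdge v j) = true := fun j => by
    rw [bubbledState, (L.halfEdge v j).2, Function.update_self]
  unfold vertexMap
  simp only [LinearMap.comp_apply]
  rw [coord_localMap, coord_localMap, coord_localMap]
  · have hb : BalancedAt G f v ↔ Balanced f (L.halfEdge v 0) ∧ Balanced f (L.halfEdge v 1) ∧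
        Balanced f (L.halfEdge v 2) := by
      rw [balancedAt_iff L]
      simp [Fin.forall_fin_succ]
    simp only [hb, vertexScalar, Fin.prod_univ_three]
    split_ifs <;> first | ring1 | tauto
  · rw [Function.update_self, hat]; decide
  · exact fun h' hh => Function.update_of_ne hh _ _
  · rw [Function.update_self, Function.update_of_ne h01.symm, hat]; decide
  · exact fun h' hh => Function.update_of_ne hh _ _
  · rw [hat', Function.update_of_ne h12.symm, Function.update_of_ne h02.symm, hat]; decide
  · intro h' hh
    by_cases hv' : G.vert h' = v
    · obtain ⟨j, hj⟩ := (L.halfEdge v).surjective ⟨h', hv'⟩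
      have hj' : h' = L.halfEdge v j := by rw [hj]
      subst hj'
      rw [hat']
      fin_cases j
      · simp [Function.update_of_ne h01]
      · simp
      · exact absurd rfl hh
    · have hne : ∀ j, h' ≠ L.halfEdge v j := fun j e => hv' (e ▸ (L.halfEdge v j).2)
      rw [Function.update_of_ne (hne _), Function.update_of_ne (hne _)]
      simp [bubbledState, hv']

theorem edgeMap_update (Γ : G.OrientedRibbonGraph) (L : G.Labelling) (n : ℕ) {v : V}
    {ν : V → Bool} (hv : ν v = false) :
    Γ.edgeMap L n ν (Function.update ν v true) =
      edgeSign L ν v • Γ.vertexMap L n v ν (Function.update ν v true) := by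
  unfold edgeMap
  rw [Finset.sum_eq_single v]
  · rw [if_pos ⟨hv, rfl⟩]; rfl
  · intro u _ huv
    rw [if_neg]
    rintro ⟨hu, e⟩
    have := congrFun e u
    rw [Function.update_of_ne huv, Function.update_self, hu] at this
    cases this
  · simp

theorem edgeMap_eq_zero (Γ : G.OrientedRibbonGraph) (L : G.Labelling) (n : ℕ) {ν ν' : V → Bool}
    (h : ∀ v, ν v = false → ν' ≠ Function.update ν v true) : Γ.edgeMap L n ν ν' = 0 := by
  unfold edgeMap
  exact Finset.sum_eq_zero fun v _ => if_neg fun H => h v H.1 H.2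

theorem coord_edgeMap_update (Γ : G.OrientedRibbonGraph) (L : G.Labelling) {v : V} {ν : V → Bool}
    (hv : ν v = false) (f : (E × Bool) × Bool → Fin 2) (x : Γ.StateSpace 2 ν) :
    Γ.coord (Γ.bubbledState (Function.update ν v true)) f
        (Γ.edgeMap L 2 ν (Function.update ν v true) x) =
      if BalancedAt G f v then
        edgeSign L ν v * vertexScalar L v f * Γ.coord (Γ.bubbledState ν) f x else 0 := by
  rw [edgeMap_update Γ L 2 hv, LinearMap.smul_apply, map_smul, coord_vertexMap Γ L hv, smul_eq_mul]
  split_ifs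
  · ring
  · simp

end Multigraph.OrientedRibbonGraph

/-! ### Color basis, adjoints and harmonic vectors -/

theorem exp_two_pi_div_two : Complex.exp (2 * Real.pi * Complex.I / (2 : ℕ)) = -1 := by
  rw [← Complex.exp_pi_mul_I]
  congr 1
  push_cast
  ring

theorem colorVec_two {ι : Type*} [Fintype ι] (I a : ι → Fin 2) :
    colorVec 2 I a = ∏ c, (1 / 2 * (-1) ^ ((I c : ℕ) * (a c : ℕ))) := by
  unfold colorVec
  rw [exp_two_pi_div_two]
  simp

/-- The matrix of signs `(-1) ^ (i * k)` is inverse to itself up to a factor `1/2` per circle, which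
is the normalization of the colors. -/
theorem colorBasis_repr_two {ι : Type*} [Fintype ι] [DecidableEq ι] (x : TensorPow 2 ι)
    (I : ι → Fin 2) :
    (colorBasis 2 ι).repr x I = ∑ a, (∏ c, (-1) ^ ((I c : ℕ) * (a c : ℕ))) * x a := by
  let φ : TensorPow 2 ι →ₗ[ℂ] ℂ :=
    ∑ a, (∏ c, (-1) ^ ((I c : ℕ) * (a c : ℕ)) : ℂ) • LinearMap.proj a
  have h : (colorBasis 2 ι).coord I = φ := by
    refine (colorBasis 2 ι).ext fun J => ?_
    have hJ : colorBasis 2 ι J = colorVec 2 J := by simp [colorBasis]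
    have hφ : φ (colorBasis 2 ι J) = ∏ c, ∑ k : Fin 2,
        ((-1) ^ ((I c : ℕ) * (k : ℕ)) * (1 / 2 * (-1) ^ ((J c : ℕ) * (k : ℕ))) : ℂ) := by
      rw [Finset.prod_univ_sum, Fintype.piFinset_univ]
      simp only [φ, hJ, LinearMap.coe_sum, Finset.sum_apply, LinearMap.smul_apply,
        LinearMap.proj_apply, smul_eq_mul, colorVec_two, ← Finset.prod_mul_distrib]
    have hδ : ∀ i j : Fin 2, ∑ k : Fin 2,
        ((-1) ^ ((i : ℕ) * (k : ℕ)) * (1 / 2 * (-1) ^ ((j : ℕ) * (k : ℕ))) : ℂ) =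
          if i = j then 1 else 0 := by
      intro i j
      fin_cases i <;> fin_cases j <;> norm_num [Fin.sum_univ_two]
    rw [hφ, Module.Basis.coord_apply, Module.Basis.repr_self, Finsupp.single_apply]
    simp only [hδ]
    by_cases hIJ : J = I
    · simp [hIJ]
    · obtain ⟨c, hc⟩ := Function.ne_iff.mp (Ne.symm hIJ)
      rw [if_neg hIJ]
      exact (Finset.prod_eq_zero (Finset.mem_univ c) (if_neg hc)).symm
  have := congrArg (fun ψ => ψ x) h
  simpa [φ] using this

theorem colorAdjoint_repr (n : ℕ) [NeZero n] {ι κ : Type*} [Fintype ι] [DecidableEq ι] [Fintype κ]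
    [DecidableEq κ] (T : TensorPow n ι →ₗ[ℂ] TensorPow n κ) (y : TensorPow n κ) (I : ι → Fin n) :
    (colorBasis n ι).repr (colorAdjoint n T y) I =
      ∑ J, conj ((colorBasis n κ).repr (T (colorBasis n ι I)) J) * (colorBasis n κ).repr y J := by
  rw [← LinearMap.toMatrix_mulVec_repr (colorBasis n κ) (colorBasis n ι), colorAdjoint,
    LinearMap.toMatrix_toLin]
  simp [Matrix.mulVec, dotProduct, LinearMap.toMatrix_apply]

namespace Multigraph.OrientedRibbonGraph

variable {V E : Type*} {G : Multigraph V E}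

/-- The product of the rescaling factors over the circles of a state. -/
def circleScalar [Finite E] {Γ : G.OrientedRibbonGraph} {α : E × Bool → Bool}
    {f : (E × Bool) × Bool → Fin 2} (hf : Γ.Compatible α f) : ℂ :=
  ∏ c, crossingScalar (colorOfCircle hf c)

theorem circleScalar_ne_zero [Finite E] {Γ : G.OrientedRibbonGraph} {α : E × Bool → Bool}
    {f : (E × Bool) × Bool → Fin 2} (hf : Γ.Compatible α f) : circleScalar hf ≠ 0 :=
  Finset.prod_ne_zero_iff.2 fun _ _ => crossingScalar_ne_zero _

/-- Adjoints refer to the orthonormal color basis, while the maps are simplest in the rescaled one.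
The two kinds of coordinates differ by nonzero factors, so they vanish together, which is all that
harmonicity needs. -/
theorem repr_eq_circleScalar_mul_coord [Finite E] (Γ : G.OrientedRibbonGraph)
    {α : E × Bool → Bool} {f : (E × Bool) × Bool → Fin 2} (hf : Γ.Compatible α f)
    (x : TensorPow 2 (Γ.Circle α)) :
    (colorBasis 2 (Γ.Circle α)).repr x (colorOfCircle hf) = circleScalar hf * Γ.coord α f x := by
  rw [colorBasis_repr_two, coord_apply Γ hf, Finset.mul_sum]
  refine Finset.sum_congr rfl fun a _ => ?_
  rw [← mul_assoc, circleScalar, ← Finset.prod_mul_distrib]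
  congr 1
  refine Finset.prod_congr rfl fun c _ => ?_
  rw [dualFactor, mul_inv_cancel_left₀ (crossingScalar_ne_zero _)]

/-- Colorings of the circles are compatible colorings of the points. -/
def coloringEquiv (Γ : G.OrientedRibbonGraph) (α : E × Bool → Bool) (X : Type*) :
    (Γ.Circle α → X) ≃ {f : (E × Bool) × Bool → X // Γ.Compatible α f} where
  toFun I := ⟨fun p => I (Γ.circle α p), fun p q h => congrArg I (Γ.compatible_circle α p q h)⟩
  invFun f := colorOfCircle f.2
  left_inv I := by
    funext c
    induction c using Quot.ind
    rfl
  right_inv f := rfl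

theorem coord_eq_zero_iff_repr_eq_zero [Finite E] (Γ : G.OrientedRibbonGraph)
    {α : E × Bool → Bool} {f : (E × Bool) × Bool → Fin 2} (hf : Γ.Compatible α f)
    (x : TensorPow 2 (Γ.Circle α)) :
    Γ.coord α f x = 0 ↔ (colorBasis 2 (Γ.Circle α)).repr x (colorOfCircle hf) = 0 := by
  rw [repr_eq_circleScalar_mul_coord, mul_eq_zero, or_iff_right (circleScalar_ne_zero hf)]

theorem eq_of_coord_eq [Finite E] (Γ : G.OrientedRibbonGraph) {α : E × Bool → Bool}
    {x y : TensorPow 2 (Γ.Circle α)} (h : ∀ f, Γ.Compatible α f → Γ.coord α f x = Γ.coord α f y) :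
    x = y := by
  refine (colorBasis 2 (Γ.Circle α)).ext_elem fun I => ?_
  obtain ⟨f, rfl⟩ := (Γ.coloringEquiv α (Fin 2)).symm.surjective I
  change (colorBasis 2 (Γ.Circle α)).repr x (colorOfCircle f.2) = _
  rw [repr_eq_circleScalar_mul_coord, h _ f.2, ← repr_eq_circleScalar_mul_coord]
  rfl

theorem coord_colorBasis [Finite E] (Γ : G.OrientedRibbonGraph) {α : E × Bool → Bool}
    {f g : (E × Bool) × Bool → Fin 2} [Decidable (f = g)] (hf : Γ.Compatible α f)
    (hg : Γ.Compatible α g) :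
    Γ.coord α f (colorBasis 2 (Γ.Circle α) (colorOfCircle hg)) =
      if f = g then (circleScalar hf)⁻¹ else 0 := by
  have h := Γ.repr_eq_circleScalar_mul_coord hf (colorBasis 2 (Γ.Circle α) (colorOfCircle hg))
  rw [Module.Basis.repr_self, Finsupp.single_apply] at h
  have hc := circleScalar_ne_zero hf
  have : colorOfCircle hg = colorOfCircle hf ↔ f = g := by
    have := (Γ.coloringEquiv α (Fin 2)).symm.injective.eq_iff (a := ⟨g, hg⟩) (b := ⟨f, hf⟩)
    rw [Subtype.mk.injEq] at this
    exact this.trans eq_comm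
  simp only [this] at h
  split_ifs at h ⊢
  · exact (eq_inv_of_mul_eq_one_right h.symm)
  · exact (mul_eq_zero.1 h.symm).resolve_left hc

/-- Every assignment of coordinates to the compatible colorings comes from a vector. -/
theorem exists_coord_eq [Finite E] (Γ : G.OrientedRibbonGraph) (α : E × Bool → Bool)
    (c : ((E × Bool) × Bool → Fin 2) → ℂ) :
    ∃ x : TensorPow 2 (Γ.Circle α), ∀ f, Γ.Compatible α f → Γ.coord α f x = c f := by
  refine ⟨(colorBasis 2 (Γ.Circle α)).equivFun.symm fun I =>
    circleScalar (Γ.coloringEquiv α (Fin 2) I).2 * c (Γ.coloringEquiv α (Fin 2) I).1, ?_⟩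
  intro f hf
  have h := Γ.repr_eq_circleScalar_mul_coord hf ((colorBasis 2 (Γ.Circle α)).equivFun.symm fun I =>
    circleScalar (Γ.coloringEquiv α (Fin 2) I).2 * c (Γ.coloringEquiv α (Fin 2) I).1)
  rw [← Module.Basis.equivFun_apply, LinearEquiv.apply_symm_apply] at h
  exact (mul_left_cancel₀ (circleScalar_ne_zero hf) h).symm

theorem compatible_update_iff [DecidableEq V] (Γ : G.OrientedRibbonGraph)
    {f : (E × Bool) × Bool → Fin 2} {v : V}
    (hf : BalancedAt G f v) (ν : V → Bool) (b : Bool) :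
    Γ.Compatible (Γ.bubbledState (Function.update ν v b)) f ↔
      Γ.Compatible (Γ.bubbledState ν) f := by
  have key : ∀ h, f (h, false) = f (h, true) ∨
      Γ.bubbledState (Function.update ν v b) h = Γ.bubbledState ν h := by
    intro h
    by_cases hv : G.vert h = v
    · exact Or.inl (hf h hv)
    · exact Or.inr (by simp [bubbledState, hv])
  exact ⟨fun H => H.congr fun h => (key h).imp id Eq.symm, fun H => H.congr key⟩

variable [Fintype V] [DecidableEq V] [Fintype E] [DecidableEq E]

theorem edgeMap_update_eq_zero_iff (Γ : G.OrientedRibbonGraph) (L : G.Labelling) {v : V}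
    {ν : V → Bool} (hv : ν v = false) (x : Γ.StateSpace 2 ν) :
    Γ.edgeMap L 2 ν (Function.update ν v true) x = 0 ↔
      ∀ f, Γ.Compatible (Γ.bubbledState ν) f → BalancedAt G f v →
        Γ.coord (Γ.bubbledState ν) f x = 0 := by
  have hs : edgeSign L ν v ≠ 0 := left_ne_zero_of_mul_eq_one (edgeSign_mul_self L ν v)
  constructor
  · intro H f _ hb
    have := Γ.coord_edgeMap_update L hv f x
    rw [H, map_zero, if_pos hb] at this
    exact (mul_eq_zero.1 this.symm).resolve_left (mul_ne_zero hs (vertexScalar_ne_zero _ _ _))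
  · intro H
    refine Γ.eq_of_coord_eq fun f hf => ?_
    rw [coord_edgeMap_update Γ L hv, map_zero]
    split_ifs with hb
    · rw [H f ((Γ.compatible_update_iff hb ν true).1 hf) hb, mul_zero]
    · rfl

theorem colorAdjoint_edgeMap_update_eq_zero_iff (Γ : G.OrientedRibbonGraph) (L : G.Labelling)
    {v : V} {ν : V → Bool} (hv : ν v = false) (y : Γ.StateSpace 2 (Function.update ν v true)) :
    colorAdjoint 2 (Γ.edgeMap L 2 ν (Function.update ν v true)) y = 0 ↔
      ∀ f, Γ.Compatible (Γ.bubbledState (Function.update ν v true)) f → BalancedAt G f v →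
        Γ.coord (Γ.bubbledState (Function.update ν v true)) f y = 0 := by
  have hs : edgeSign L ν v ≠ 0 := left_ne_zero_of_mul_eq_one (edgeSign_mul_self L ν v)
  -- In color bases the map is diagonal with nonzero entries exactly at the colorings balanced at
  -- `v`; its conjugate transpose has the same support.
  have entry : ∀ f g (hf : Γ.Compatible (Γ.bubbledState ν) f)
      (hg : Γ.Compatible (Γ.bubbledState (Function.update ν v true)) g),
      (colorBasis 2 _).repr (Γ.edgeMap L 2 ν (Function.update ν v true)
        (colorBasis 2 _ (colorOfCircle hf))) (colorOfCircle hg) =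
      if BalancedAt G g v ∧ g = f then circleScalar hg * (edgeSign L ν v * vertexScalar L v g *
        (circleScalar hf)⁻¹) else 0 := by
    intro f g hf hg
    rw [repr_eq_circleScalar_mul_coord, coord_edgeMap_update Γ L hv]
    by_cases hb : BalancedAt G g v
    · rw [if_pos hb, coord_colorBasis Γ ((Γ.compatible_update_iff hb ν true).1 hg) hf]
      by_cases hgf : g = f
      · subst hgf
        simp [hb]
      · simp [hgf]
    · simp [hb]
  constructor
  · intro H f hf hb
    have hf' := (Γ.compatible_update_iff hb ν true).1 hf
    have h := colorAdjoint_repr 2 (Γ.edgeMap L 2 ν (Function.update ν v true)) y (colorOfCircle hf')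
    rw [H, map_zero, Finset.sum_eq_single (colorOfCircle hf), entry, if_pos ⟨hb, rfl⟩,
      Finsupp.zero_apply] at h
    · rw [coord_eq_zero_iff_repr_eq_zero Γ hf]
      refine (mul_eq_zero.1 h.symm).resolve_left ?_
      rw [← ne_eq, map_ne_zero]
      exact mul_ne_zero (circleScalar_ne_zero hf) (mul_ne_zero
        (mul_ne_zero hs (vertexScalar_ne_zero _ _ _)) (inv_ne_zero (circleScalar_ne_zero hf')))
    · intro J _ hJ
      obtain ⟨⟨g, hg⟩, rfl⟩ := (Γ.coloringEquiv _ (Fin 2)).symm.surjective J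
      have := entry f g hf' hg
      rw [if_neg] at this
      · change conj ((colorBasis 2 _).repr _ (colorOfCircle hg)) * _ = 0
        rw [this, map_zero, zero_mul]
      · rintro ⟨_, rfl⟩
        exact hJ rfl
    · simp
  · intro H
    refine (colorBasis 2 _).ext_elem fun I => ?_
    rw [colorAdjoint_repr, map_zero, Finsupp.zero_apply]
    refine Finset.sum_eq_zero fun J _ => ?_
    obtain ⟨⟨f, hf⟩, rfl⟩ := (Γ.coloringEquiv _ (Fin 2)).symm.surjective I
    obtain ⟨⟨g, hg⟩, rfl⟩ := (Γ.coloringEquiv _ (Fin 2)).symm.surjective J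
    change conj ((colorBasis 2 _).repr (Γ.edgeMap L 2 ν (Function.update ν v true)
        (colorBasis 2 _ (colorOfCircle hf))) (colorOfCircle hg)) *
        (colorBasis 2 _).repr y (colorOfCircle hg) = 0
    rw [entry]
    by_cases hb : BalancedAt G g v
    · rw [(coord_eq_zero_iff_repr_eq_zero Γ hg y).1 (H g hg hb), mul_zero]
    · simp [hb]

/-- Harmonic vectors are the combinations of the colors that are balanced at no vertex. -/
theorem mem_harmonic_iff (Γ : G.OrientedRibbonGraph) (L : G.Labelling) {ν : V → Bool}
    (x : Γ.StateSpace 2 ν) :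
    x ∈ Γ.harmonic L 2 ν ↔ ∀ f, Γ.Compatible (Γ.bubbledState ν) f →
      (∃ v, BalancedAt G f v) → Γ.coord (Γ.bubbledState ν) f x = 0 := by
  simp only [harmonic, Submodule.mem_inf, LinearMap.mem_ker, funext_iff, LinearMap.pi_apply,
    Pi.zero_apply (M := fun _ => _)]
  constructor
  · rintro ⟨h1, h2⟩ f hf ⟨v, hb⟩
    -- A `0`-smoothed vertex gives an outgoing map, a `1`-smoothed one an incoming map. Both impose
    -- the same vanishing condition.
    rcases hv : ν v with _ | _
    · exact (Γ.edgeMap_update_eq_zero_iff L hv x).1 (funext (h1 _)) f hf hb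
    · obtain ⟨μ, hμ, rfl⟩ : ∃ μ : V → Bool, μ v = false ∧ ν = Function.update μ v true :=
        ⟨Function.update ν v false, by simp, by simp [← hv]⟩
      exact (Γ.colorAdjoint_edgeMap_update_eq_zero_iff L hμ x).1 (funext (h2 _)) f hf hb
  · intro H
    constructor
    · intro ν'
      rw [← funext_iff]
      by_cases h : ∃ v, ν v = false ∧ ν' = Function.update ν v true
      · obtain ⟨v, hv, rfl⟩ := h
        exact (Γ.edgeMap_update_eq_zero_iff L hv x).2 fun f hf hb => H f hf ⟨v, hb⟩
      · push Not at h
        rw [edgeMap_eq_zero Γ L 2 h]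
        rfl
    · intro μ
      rw [← funext_iff]
      by_cases h : ∃ v, μ v = false ∧ ν = Function.update μ v true
      · obtain ⟨v, hv, rfl⟩ := h
        exact (Γ.colorAdjoint_edgeMap_update_eq_zero_iff L hv x).2 fun f hf hb => H f hf ⟨v, hb⟩
      · push Not at h
        rw [edgeMap_eq_zero Γ L 2 h, colorAdjoint]
        simp
        rfl

/-- The colorings of the circles of a vertex state that are balanced at no vertex. -/
def unbalancedColorings (Γ : G.OrientedRibbonGraph) (ν : V → Bool) :
    Set ((E × Bool) × Bool → Fin 2) :=
  {f | Γ.Compatible (Γ.bubbledState ν) f ∧ ∀ v, ¬ BalancedAt G f v}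

theorem finrank_harmonic (Γ : G.OrientedRibbonGraph) (L : G.Labelling) (ν : V → Bool) :
    Module.finrank ℂ (Γ.harmonic L 2 ν) = (Γ.unbalancedColorings ν).ncard := by
  set b := colorBasis 2 (Γ.Circle (Γ.bubbledState ν))
  set e := Γ.coloringEquiv (Γ.bubbledState ν) (Fin 2)
  set N : Set (Γ.Circle (Γ.bubbledState ν) → Fin 2) := {I | ∀ v, ¬ BalancedAt G (e I).1 v}
  -- In the color basis the harmonic space is a coordinate subspace, so its dimension is a count of
  -- colorings.
  have hmap : (Γ.harmonic L 2 ν).map (b.repr : _ →ₗ[ℂ] _) = Finsupp.supported ℂ ℂ N := by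
    ext y
    obtain ⟨x, rfl⟩ := b.repr.surjective y
    rw [Submodule.mem_map_equiv, LinearEquiv.symm_apply_apply, mem_harmonic_iff,
      Finsupp.mem_supported']
    constructor
    · intro H I hI
      have hI' : ∃ v, BalancedAt G (e I).1 v := by simpa [N] using hI
      have := (Γ.coord_eq_zero_iff_repr_eq_zero (e I).2 x).1 (H _ (e I).2 hI')
      rwa [show colorOfCircle (e I).2 = I from e.symm_apply_apply I] at this
    · rintro H f hf ⟨v, hb⟩
      exact (Γ.coord_eq_zero_iff_repr_eq_zero hf x).2 (H _ fun hN => hN v hb)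
  rw [← LinearEquiv.finrank_map_eq b.repr, hmap, (Finsupp.supportedEquivFinsupp N).finrank_eq,
    Module.finrank_finsupp_self, ← Nat.card_eq_fintype_card, ← Nat.card_coe_set_eq]
  exact Nat.card_congr ((e.subtypeEquiv (q := fun f => ∀ v, ¬ BalancedAt G f.1 v)
    fun _ => Iff.rfl).trans (Equiv.subtypeSubtypeEquivSubtypeInter
      (fun f => Γ.Compatible (Γ.bubbledState ν) f) fun f => ∀ v, ¬ BalancedAt G f v))

theorem totalMatching_two (Γ : G.OrientedRibbonGraph) (L : G.Labelling) :
    Γ.totalMatching L 2 = ∑ ν, (Γ.unbalancedColorings ν).ncard := by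
  simp [totalMatching, totalMatchingPoly, Polynomial.eval_finsetSum, finrank_harmonic]

theorem totalMatching_two_pos_iff (Γ : G.OrientedRibbonGraph) (L : G.Labelling) :
    0 < Γ.totalMatching L 2 ↔ ∃ ν, (Γ.unbalancedColorings ν).Nonempty := by
  rw [totalMatching_two, Finset.sum_pos_iff]
  simp [Set.ncard_pos (Set.toFinite _)]

end Multigraph.OrientedRibbonGraph

/-! ### Homology: one cube complex for each coloring -/

namespace Multigraph.OrientedRibbonGraph

variable {V E : Type*} {G : Multigraph V E}

theorem edgeSign_update [Fintype V] [DecidableEq V] (L : G.Labelling) {ν : V → Bool} {u : V}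
    (hu : ν u = false) (v : V) :
    edgeSign L (Function.update ν u true) v =
      (if L.vertex u < L.vertex v then -1 else 1) * edgeSign L ν v := by
  unfold edgeSign
  have hmem : u ∉ Finset.univ.filter fun w => ν w = true ∧ L.vertex w < L.vertex v := by simp [hu]
  split_ifs with h
  · have : (Finset.univ.filter fun w => Function.update ν u true w = true ∧
        L.vertex w < L.vertex v) =
        insert u (Finset.univ.filter fun w => ν w = true ∧ L.vertex w < L.vertex v) := by
      ext w
      by_cases hw : w = u
      · subst hw; simp [h]
      · simp [hw]
    rw [this, Finset.card_insert_of_notMem hmem, pow_succ']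
  · rw [one_mul]
    congr 2
    ext w
    by_cases hw : w = u
    · subst hw; simp [h]
    · simp [hw]

theorem edgeSign_anticomm [Fintype V] [DecidableEq V] (L : G.Labelling) {ν : V → Bool} {u v : V}
    (huv : u ≠ v) (hu : ν u = false) (hv : ν v = false) :
    edgeSign L (Function.update ν u true) v * edgeSign L (Function.update ν v true) u =
      -(edgeSign L ν u * edgeSign L ν v) := by
  rw [edgeSign_update L hu, edgeSign_update L hv]
  rcases lt_or_gt_of_ne (L.vertex.injective.ne huv) with h | h
  · rw [if_pos h, if_neg h.not_gt]; ring
  · rw [if_neg h.not_gt, if_pos h]; ring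

/-- The differential on the functions on the cube of vertex states in which only the vertices in
`B` may be changed and the change of `v` has weight `k v`. -/
def cubeDifferential [Fintype V] [DecidableEq V] (L : G.Labelling) (B : V → Prop) [DecidablePred B]
    (k : V → ℂ) (X : (V → Bool) → ℂ) (ν : V → Bool) : ℂ :=
  ∑ v, if ν v = true ∧ B v then
    edgeSign L (Function.update ν v false) v * k v * X (Function.update ν v false) else 0

/-- The contracting homotopy of the cube in the direction of `v₀`. -/
def cubeHomotopy [Fintype V] [DecidableEq V] (L : G.Labelling) (k : V → ℂ) (v₀ : V)
    (X : (V → Bool) → ℂ) (μ : V → Bool) : ℂ :=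
  if μ v₀ = false then edgeSign L μ v₀ * (k v₀)⁻¹ * X (Function.update μ v₀ true) else 0

/-- A cube with a flippable direction of nonzero weight is contractible. If `v₀` is already flipped,
only the term of `v₀` survives and returns `X ν`. Otherwise the cocycle condition at the state with
`v₀` flipped expresses `X ν` through the other directions, and anticommutation of the signs matches
the terms. -/
theorem cubeDifferential_cubeHomotopy [Fintype V] [DecidableEq V] (L : G.Labelling) {B : V → Prop}
    [DecidablePred B] {k : V → ℂ} {v₀ : V} (hB : B v₀) (hk : k v₀ ≠ 0) {X : (V → Bool) → ℂ}
    {ν : V → Bool}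
    (hX : ν v₀ = false → cubeDifferential L B k X (Function.update ν v₀ true) = 0) :
    cubeDifferential L B k (cubeHomotopy L k v₀ X) ν = X ν := by
  rcases hν : ν v₀ with _ | _
  · have h := hX hν
    unfold cubeDifferential at h ⊢
    rw [← Finset.add_sum_erase _ _ (Finset.mem_univ v₀)] at h ⊢
    rw [if_neg (by simp [hν]), zero_add]
    rw [if_pos ⟨Function.update_self .., hB⟩, Function.update_idem,
      Function.update_eq_self_iff.2 hν.symm] at h
    have hs := edgeSign_mul_self L ν v₀
    have : X ν = -(edgeSign L ν v₀ * (k v₀)⁻¹) * ∑ v ∈ Finset.univ.erase v₀,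
        (if Function.update ν v₀ true v = true ∧ B v then
          edgeSign L (Function.update (Function.update ν v₀ true) v false) v * k v *
            X (Function.update (Function.update ν v₀ true) v false) else 0) := by
      rw [eq_neg_of_add_eq_zero_right h]
      field_simp
      linear_combination (-(X ν)) * hs
    rw [this, Finset.mul_sum]
    refine Finset.sum_congr rfl fun v hv => ?_
    have hv' : v ≠ v₀ := (Finset.mem_erase.1 hv).1
    rw [Function.update_of_ne hv']
    by_cases hc : ν v = true ∧ B v
    · rw [if_pos hc, if_pos hc, cubeHomotopy, Function.update_of_ne hv'.symm, if_pos hν,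
        Function.update_comm hv'.symm true false ν]
      set μ := Function.update ν v false with hμ
      have hνμ : ν = Function.update μ v true := by simp [hμ, ← hc.1]
      have := edgeSign_anticomm L (ν := μ) hv' (by simp [hμ])
        (by rw [hμ, Function.update_of_ne hv'.symm, hν])
      rw [← hνμ] at this
      linear_combination ((k v₀)⁻¹ * k v * X (Function.update μ v₀ true)) * this
    · rw [if_neg hc, if_neg hc, mul_zero]
  · unfold cubeDifferential
    rw [Finset.sum_eq_single v₀]
    · have e : Function.update ν v₀ true = ν := Function.update_eq_self_iff.2 hν.symm
      rw [if_pos ⟨hν, hB⟩, cubeHomotopy, if_pos (Function.update_self ..), Function.update_idem, e]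
      have hs := edgeSign_mul_self L (Function.update ν v₀ false) v₀
      field_simp
      linear_combination (X ν) * hs
    · intro v _ hv
      rw [cubeHomotopy, Function.update_of_ne hv.symm, hν]
      simp
    · simp

theorem weight_update [Fintype V] [DecidableEq V] {ν : V → Bool} {v : V} (hv : ν v = false) :
    weight (Function.update ν v true) = weight ν + 1 := by
  unfold weight
  rw [← Finset.card_insert_of_notMem (a := v) (by simp [hv])]
  congr 1
  ext w
  by_cases hw : w = v
  · subst hw; simp
  · simp [hw]

/-- The coordinates of a chain at a coloring of the points, extended by zero to all states. -/
def chainCoord [Fintype V] [Fintype E] (Γ : G.OrientedRibbonGraph) {i : ℕ} (f : (E × Bool) × Bool → Fin 2)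
    (x : Γ.Chain 2 i) (ν : V → Bool) : ℂ :=
  if h : weight ν = i then Γ.coord (Γ.bubbledState ν) f (x ⟨ν, h⟩) else 0

theorem chainCoord_coe [Fintype V] [Fintype E] (Γ : G.OrientedRibbonGraph) {i : ℕ} (f : (E × Bool) × Bool → Fin 2)
    (x : Γ.Chain 2 i) (ν : {ν : V → Bool // weight ν = i}) :
    Γ.chainCoord f x ν.1 = Γ.coord (Γ.bubbledState ν.1) f (x ν) :=
  dif_pos ν.2

theorem chain_ext [Fintype V] [Fintype E] (Γ : G.OrientedRibbonGraph) {i : ℕ} {x y : Γ.Chain 2 i}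
    (h : ∀ f, ∀ ν : {ν : V → Bool // weight ν = i}, Γ.Compatible (Γ.bubbledState ν.1) f →
      Γ.chainCoord f x ν.1 = Γ.chainCoord f y ν.1) : x = y := by
  funext ν
  refine Γ.eq_of_coord_eq fun f hf => ?_
  rw [← chainCoord_coe, ← chainCoord_coe, h f ν hf]

variable [Fintype V] [DecidableEq V] [Fintype E] [DecidableEq E]

theorem coord_edgeMap (Γ : G.OrientedRibbonGraph) (L : G.Labelling) (ν ν' : V → Bool)
    (f : (E × Bool) × Bool → Fin 2) (x : Γ.StateSpace 2 ν) :
    Γ.coord (Γ.bubbledState ν') f (Γ.edgeMap L 2 ν ν' x) =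
      ∑ v, if ν v = false ∧ ν' = Function.update ν v true then
        if BalancedAt G f v then
          edgeSign L ν v * vertexScalar L v f * Γ.coord (Γ.bubbledState ν) f x else 0
      else 0 := by
  rw [edgeMap, LinearMap.sum_apply, map_sum]
  refine Finset.sum_congr rfl fun v _ => ?_
  split_ifs with h hb
  · obtain ⟨hv, rfl⟩ := h
    rw [LinearMap.smul_apply, map_smul, coord_vertexMap Γ L hv, if_pos hb, smul_eq_mul, edgeSign]
    ring
  · obtain ⟨hv, rfl⟩ := h
    rw [LinearMap.smul_apply, map_smul, coord_vertexMap Γ L hv, if_neg hb, smul_zero]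
  · simp

/-- The differential does not mix colorings: its coordinate at `f` depends only on the coordinates
at the same `f`. -/
theorem chainCoord_differential (Γ : G.OrientedRibbonGraph) (L : G.Labelling) {i : ℕ}
    (x : Γ.Chain 2 i) (f : (E × Bool) × Bool → Fin 2)
    (ν' : {ν : V → Bool // weight ν = i + 1}) :
    Γ.chainCoord f (Γ.differential L 2 i x) ν'.1 =
      cubeDifferential L (BalancedAt G f) (fun v => vertexScalar L v f) (Γ.chainCoord f x)
        ν'.1 := by
  rw [chainCoord_coe]
  have h1 : Γ.coord (Γ.bubbledState ν'.1) f (Γ.differential L 2 i x ν') =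
      ∑ ν : {ν : V → Bool // weight ν = i},
        ∑ v, if ν.1 v = false ∧ ν'.1 = Function.update ν.1 v true then
        if BalancedAt G f v then
          edgeSign L ν.1 v * vertexScalar L v f * Γ.chainCoord f x ν.1 else 0
        else 0 := by
    simp only [differential, LinearMap.pi_apply, LinearMap.sum_apply, LinearMap.comp_apply,
      LinearMap.proj_apply, map_sum, coord_edgeMap, chainCoord_coe]
  rw [h1, Finset.sum_comm, cubeDifferential]
  refine Finset.sum_congr rfl fun v _ => ?_
  by_cases hv : ν'.1 v = true
  · have hw : weight (Function.update ν'.1 v false) = i := by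
      have := weight_update (ν := Function.update ν'.1 v false) (v := v) (by simp)
      rw [Function.update_idem, Function.update_eq_self_iff.2 hv.symm, ν'.2] at this
      omega
    -- The only state from which flipping `v` leads to `ν'` is `ν'` with `v` reset.
    rw [Finset.sum_eq_single ⟨Function.update ν'.1 v false, hw⟩]
    · rw [if_pos ⟨by simp, by simp [← hv]⟩]
      simp only [hv, true_and]
    · rintro ⟨ν, hν⟩ _ hne
      rw [if_neg]
      rintro ⟨h2, h3⟩
      refine hne (Subtype.ext ?_)
      simp only at h2 h3 ⊢
      rw [h3, Function.update_idem, Function.update_eq_self_iff.2 h2.symm]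
    · simp
  · rw [if_neg fun h => hv h.1]
    refine Finset.sum_eq_zero fun ν _ => if_neg fun h => hv ?_
    rw [h.2, Function.update_self]

theorem coord_eq_zero_of_mem_boundaries (Γ : G.OrientedRibbonGraph) (L : G.Labelling) {i : ℕ}
    {x : Γ.Chain 2 i} (hx : x ∈ Γ.boundaries L 2 i) {f : (E × Bool) × Bool → Fin 2}
    (hf : ∀ v, ¬ BalancedAt G f v) (ν : {ν : V → Bool // weight ν = i}) :
    Γ.chainCoord f x ν.1 = 0 := by
  cases i with
  | zero =>
    rw [show x = 0 from hx, chainCoord_coe]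
    exact map_zero _
  | succ i =>
    obtain ⟨y, rfl⟩ := hx
    rw [chainCoord_differential, cubeDifferential]
    exact Finset.sum_eq_zero fun v _ => if_neg fun h => hf v h.2

/-- The basis vector of an unbalanced coloring is a cocycle since no direction of its cube can be
flipped; for the same reason no boundary has a nonzero coordinate there. -/
theorem finrank_filteredHomology_pos (Γ : G.OrientedRibbonGraph) (L : G.Labelling)
    {ν : V → Bool} (h : (Γ.unbalancedColorings ν).Nonempty) :
    0 < Module.finrank ℂ (Γ.FilteredHomology L 2 (weight ν)) := by
  obtain ⟨f, hf, hunb⟩ := h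
  set x : Γ.Chain 2 (weight ν) := Pi.single ⟨ν, rfl⟩ (colorBasis 2 _ (colorOfCircle hf)) with hx
  have hcoord : ∀ g μ, g ≠ f → Γ.Compatible (Γ.bubbledState μ) g → Γ.chainCoord g x μ = 0 := by
    intro g μ hg hcomp
    unfold chainCoord
    split_ifs with hw
    · by_cases hμ : μ = ν
      · subst hμ
        rw [hx, Pi.single_eq_same, coord_colorBasis Γ hcomp hf, if_neg hg]
      · rw [hx, Pi.single_eq_of_ne fun e => hμ (congrArg Subtype.val e), map_zero]
    · rfl
  have hker : x ∈ LinearMap.ker (Γ.differential L 2 (weight ν)) := by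
    rw [LinearMap.mem_ker]
    refine Γ.chain_ext fun g ν' hg => ?_
    rw [chainCoord_differential, chainCoord_coe, Pi.zero_apply, map_zero, cubeDifferential]
    refine Finset.sum_eq_zero fun v _ => ?_
    split_ifs with hv
    · have hgf : g ≠ f := fun e => hunb v (e ▸ hv.2)
      rw [hcoord g _ hgf ((Γ.compatible_update_iff hv.2 _ _).2 hg), mul_zero]
    · rfl
  have hne : Γ.chainCoord f x ν ≠ 0 := by
    rw [chainCoord, dif_pos rfl, hx, Pi.single_eq_same, coord_colorBasis Γ hf hf, if_pos rfl]
    exact inv_ne_zero (circleScalar_ne_zero hf)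
  have : Nontrivial (Γ.FilteredHomology L 2 (weight ν)) := by
    refine Submodule.Quotient.nontrivial_iff.2 fun htop => hne ?_
    have hmem : (⟨x, hker⟩ : LinearMap.ker (Γ.differential L 2 (weight ν))) ∈
        (Γ.boundaries L 2 (weight ν)).submoduleOf _ := htop ▸ Submodule.mem_top
    exact Γ.coord_eq_zero_of_mem_boundaries L hmem hunb ⟨ν, rfl⟩
  exact Module.finrank_pos

theorem ker_differential_le_boundaries (Γ : G.OrientedRibbonGraph) (L : G.Labelling)
    (h : ∀ ν, ¬ (Γ.unbalancedColorings ν).Nonempty) (i : ℕ) :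
    LinearMap.ker (Γ.differential L 2 i) ≤ Γ.boundaries L 2 i := by
  classical
  intro x hx
  rw [LinearMap.mem_ker] at hx
  have hbal : ∀ ν f, Γ.Compatible (Γ.bubbledState ν) f → ∃ v, BalancedAt G f v := by
    intro ν f hf
    by_contra! H
    exact h ν ⟨f, hf, H⟩
  -- The contracting direction may depend on `f` but must be the same for all states, which is why
  -- it is chosen from `f` alone.
  let Y : ((E × Bool) × Bool → Fin 2) → (V → Bool) → ℂ := fun f =>
    if hf : ∃ v, BalancedAt G f v then
      cubeHomotopy L (fun v => vertexScalar L v f) hf.choose (Γ.chainCoord f x)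
    else 0
  have hY : ∀ f (ν : {ν : V → Bool // weight ν = i}), Γ.Compatible (Γ.bubbledState ν.1) f →
      cubeDifferential L (BalancedAt G f) (fun v => vertexScalar L v f) (Y f) ν.1 =
        Γ.chainCoord f x ν.1 := by
    intro f ν hf
    have hf' := hbal ν.1 f hf
    simp only [Y, dif_pos hf']
    refine cubeDifferential_cubeHomotopy L hf'.choose_spec (vertexScalar_ne_zero _ _ _) fun hν => ?_
    have := Γ.chainCoord_differential L x f
      ⟨Function.update ν.1 hf'.choose true, by rw [weight_update hν, ν.2]⟩
    rw [← this, hx, chainCoord_coe, Pi.zero_apply, map_zero]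
  cases i with
  | zero =>
    -- In weight zero no vertex is `1`-smoothed, so the differential of the homotopy is an empty
    -- sum.
    change x = 0
    refine Γ.chain_ext fun f ν hf => ?_
    rw [← hY f ν hf, chainCoord_coe, Pi.zero_apply, map_zero, cubeDifferential]
    refine Finset.sum_eq_zero fun v _ => if_neg fun hv => ?_
    have : v ∈ (Finset.univ.filter fun v => ν.1 v = true) := by simp [hv.1]
    rw [Finset.card_eq_zero.1 ν.2] at this
    simp at this
  | succ i =>
    -- Only coordinates at compatible colorings can be prescribed. This suffices: the differential
    -- flips only vertices where `f` is balanced, and these flips preserve compatibility.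
    choose y hy using fun μ : {μ : V → Bool // weight μ = i} =>
      Γ.exists_coord_eq (Γ.bubbledState μ.1) fun f => Y f μ.1
    refine ⟨y, Γ.chain_ext fun f ν hf => ?_⟩
    rw [chainCoord_differential, ← hY f ν hf]
    refine Finset.sum_congr rfl fun v _ => ?_
    split_ifs with hv
    · have hw : weight (Function.update ν.1 v false) = i := by
        have := weight_update (ν := Function.update ν.1 v false) (v := v) (by simp)
        rw [Function.update_idem, Function.update_eq_self_iff.2 hv.1.symm, ν.2] at this
        omega
      rw [chainCoord, dif_pos hw, hy ⟨_, hw⟩ f ((Γ.compatible_update_iff hv.2 _ _).2 hf)]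
    · rfl

theorem finrank_filteredHomology_pos_iff (Γ : G.OrientedRibbonGraph) (L : G.Labelling) :
    (∃ i, 0 < Module.finrank ℂ (Γ.FilteredHomology L 2 i)) ↔
      ∃ ν, (Γ.unbalancedColorings ν).Nonempty := by
  constructor
  · rintro ⟨i, hi⟩
    by_contra! H
    have htop : (Γ.boundaries L 2 i).submoduleOf (LinearMap.ker (Γ.differential L 2 i)) = ⊤ :=
      Submodule.submoduleOf_eq_top.2 (Γ.ker_differential_le_boundaries L
        (fun ν => Set.not_nonempty_iff_eq_empty.2 (H ν)) i)
    have : Subsingleton (Γ.FilteredHomology L 2 i) :=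
      Submodule.Quotient.subsingleton_iff.2 htop
    exact hi.ne' (Module.finrank_zero_of_subsingleton)
  · rintro ⟨ν, hν⟩
    exact ⟨_, Γ.finrank_filteredHomology_pos L hν⟩

end Multigraph.OrientedRibbonGraph

/-! ### Unbalanced colorings and perfect matchings -/

/-- Two fixed-point-free involutions have a common alternating two-coloring. -/
theorem exists_alternating_coloring {X : Type*} {σ τ : Equiv.Perm X}
    (hσ : Function.Involutive σ) (hτ : Function.Involutive τ) (hσ' : ∀ x, σ x ≠ x)
    (hτ' : ∀ x, τ x ≠ x) :
    ∃ o : X → Bool, (∀ x, o (σ x) = !o x) ∧ ∀ x, o (τ x) = !o x := by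
  classical
  have hσσ : σ * σ = 1 := Equiv.ext hσ
  have hττ : τ * τ = 1 := Equiv.ext hτ
  have hconj : SemiconjBy σ (σ * τ) (σ * τ)⁻¹ := by
    rw [SemiconjBy, ← mul_assoc, hσσ, one_mul, mul_inv_rev, inv_mul_cancel_right]
    exact eq_inv_of_mul_eq_one_left hττ
  -- Since `σ` inverts `σ * τ`, a relation `σ x = (σ * τ) ^ k x` yields a fixed point halfway: of
  -- `σ` for even `k`, of `τ` for odd `k`.
  have hne : ∀ x, ¬ (σ * τ).SameCycle x (σ x) := by
    rintro x ⟨k, hk⟩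
    have hkey : ∀ j : ℤ, σ (((σ * τ) ^ j) x) = ((σ * τ) ^ (-j + k)) x := by
      intro j
      have := Equiv.congr_fun (hconj.zpow_right j).eq x
      rw [Equiv.Perm.mul_apply, Equiv.Perm.mul_apply, ← hk, inv_zpow'] at this
      rw [zpow_add, Equiv.Perm.mul_apply]
      exact this
    rcases Int.even_or_odd' k with ⟨j, rfl | rfl⟩
    · refine hσ' (((σ * τ) ^ j) x) ?_
      rw [hkey, show -j + 2 * j = j by ring]
    · refine hτ' (((σ * τ) ^ j) x) ?_
      have := hkey j
      rw [show -j + (2 * j + 1) = 1 + j by ring, zpow_add, zpow_one, Equiv.Perm.mul_apply,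
        Equiv.Perm.mul_apply] at this
      exact (σ.injective this).symm
  let Q := Quotient (Equiv.Perm.SameCycle.setoid (σ * τ))
  -- Both involutions exchange the cycle of `x` under `σ * τ` with that of `σ x`. An arbitrary
  -- linear order on the cycles chooses one of each such pair.
  let _ : LinearOrder Q := IsWellOrder.linearOrder WellOrderingRel
  let q : X → Q := fun x => Quotient.mk _ x
  have hq : ∀ x y, (σ * τ).SameCycle x y → q x = q y := fun x y h => Quotient.sound h
  have hqne : ∀ x, q x ≠ q (σ x) := fun x h => hne x (Quotient.exact h)
  have hlt : ∀ x, decide (q (σ x) < q x) = !decide (q x < q (σ x)) := by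
    intro x
    rcases lt_or_gt_of_ne (hqne x) with h | h
    · simp [h, h.not_gt]
    · simp [h, h.not_gt]
  refine ⟨fun x => decide (q x < q (σ x)), fun x => ?_, fun x => ?_⟩
  · simp only [hσ x]
    exact hlt x
  · have h1 : q (τ x) = q (σ x) := hq _ _ ⟨1, by simp [hτ x]⟩
    have h2 : q (σ (τ x)) = q x := (hq _ _ ⟨1, by simp⟩).symm
    simp only [h1, h2]
    exact hlt x

namespace Multigraph.OrientedRibbonGraph

variable {V E : Type*} {G : Multigraph V E}

theorem rot_trivalent [Fintype E] [DecidableEq V] (Γ : G.OrientedRibbonGraph)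
    (htri : G.Trivalent) (h : E × Bool) :
    Γ.rot h ≠ h ∧ Γ.rot (Γ.rot h) ≠ h ∧ Γ.rot (Γ.rot (Γ.rot h)) = h ∧
      ∀ h', G.vert h' = G.vert h → h' = h ∨ h' = Γ.rot h ∨ h' = Γ.rot (Γ.rot h) := by
  set s : Finset (E × Bool) := Finset.univ.filter fun h' => G.vert h' = G.vert h with hs
  have hmem : ∀ h', h' ∈ s ↔ G.vert h' = G.vert h := by simp [hs]
  have hcard : s.card = 3 := by
    rw [← htri (G.vert h), Nat.card_eq_fintype_card, Fintype.card_subtype]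
  have hcyc : Γ.rot.IsCycleOn s := by
    refine ⟨⟨fun x hx => ?_, Γ.rot.injective.injOn, fun x hx => ?_⟩, fun x hx y hy => ?_⟩
    · rw [Finset.mem_coe, hmem] at hx ⊢
      rw [Γ.vert_rot, hx]
    · rw [Finset.mem_coe, hmem] at hx
      refine ⟨Γ.rot.symm x, ?_, Equiv.apply_symm_apply _ _⟩
      rw [Finset.mem_coe, hmem, ← Γ.vert_rot, Equiv.apply_symm_apply, hx]
    · rw [Finset.mem_coe, hmem] at hx hy
      exact Γ.sameCycle x y (hx.trans hy.symm)
  have hh : h ∈ s := (hmem h).2 rfl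
  have hpow := fun n => hcyc.pow_apply_eq hh (n := n)
  rw [hcard] at hpow
  refine ⟨fun e => ?_, fun e => ?_, (hpow 3).2 (dvd_refl 3), fun h' hv => ?_⟩
  · exact absurd ((hpow 1).1 e) (by decide)
  · exact absurd ((hpow 2).1 e) (by decide)
  · obtain ⟨n, hn, rfl⟩ := hcyc.exists_pow_eq hh ((hmem h').2 hv)
    rw [hcard] at hn
    interval_cases n
    · exact Or.inl rfl
    · exact Or.inr (Or.inl rfl)
    · exact Or.inr (Or.inr rfl)

theorem compatible_bubbledState_iff (Γ : G.OrientedRibbonGraph)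
    (ν : V → Bool) (f : (E × Bool) × Bool → Fin 2) :
    Γ.Compatible (Γ.bubbledState ν) f ↔
      (∀ e b s, f ((e, b), s) = f ((e, !b), !s)) ∧
        ∀ h, f (h, !ν (G.vert h)) = f (Γ.rot h, ν (G.vert h)) := by
  have hc : ∀ h, ((h, xor true (Γ.bubbledState ν h)) : (E × Bool) × Bool) =
      (h, !ν (G.vert h)) ∧ ((Γ.rot h, xor false (Γ.bubbledState ν (Γ.rot h))) :
        (E × Bool) × Bool) = (Γ.rot h, ν (G.vert h)) := by
    intro h
    simp [bubbledState, Γ.vert_rot]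
  constructor
  · intro H
    refine ⟨fun e b s => H _ _ (.band e b s), fun h => ?_⟩
    have := H _ _ (.corner h)
    rwa [(hc h).1, (hc h).2] at this
  · rintro ⟨h1, h2⟩ _ _ (⟨h⟩ | ⟨e, b, s⟩)
    · rw [(hc h).1, (hc h).2]
      exact h2 h
    · exact h1 e b s

/-- At a trivalent vertex, two cyclic orders agree or are opposite. -/
theorem rot_eq_or_eq_symm [Fintype E] [DecidableEq V] (Γ Γ' : G.OrientedRibbonGraph)
    (htri : G.Trivalent) (v : V) :
    (∀ h, G.vert h = v → Γ'.rot h = Γ.rot h) ∨ ∀ h, G.vert h = v → Γ'.rot h = Γ.rot.symm h := by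
  by_contra! H
  obtain ⟨⟨a, ha, hne⟩, b, hb, hne'⟩ := H
  obtain ⟨-, -, h3, h4⟩ := Γ.rot_trivalent htri a
  obtain ⟨k1, k2, k3, -⟩ := Γ'.rot_trivalent htri a
  have hv : ∀ h, G.vert h = v → h = a ∨ h = Γ.rot a ∨ h = Γ.rot (Γ.rot a) :=
    fun h hh => h4 h (hh.trans ha.symm)
  have hv1 : G.vert (Γ'.rot a) = v := by rw [Γ'.vert_rot, ha]
  have hv2 : G.vert (Γ'.rot (Γ'.rot a)) = v := by rw [Γ'.vert_rot, hv1]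
  have e1 : Γ'.rot a = Γ.rot (Γ.rot a) := by
    rcases hv _ hv1 with h | h | h
    · exact absurd h k1
    · exact absurd h hne
    · exact h
  have e2 : Γ'.rot (Γ'.rot a) = Γ.rot a := by
    rcases hv _ hv2 with h | h | h
    · exact absurd h k2
    · exact h
    · rw [← e1] at h
      exact absurd (Γ'.rot.injective h) k1
  rw [ne_eq, Equiv.eq_symm_apply] at hne'
  rcases hv b hb with rfl | rfl | rfl
  · exact hne' (by rw [e1, h3])
  · exact hne' (by rw [← e2, k3, e2])
  · exact hne' (by rw [← e1, e2, e1])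

/-- Reversing the rotation at a vertex exchanges the two ends of each corner, and flipping the
smoothing there exchanges the sides. Together they leave the set of arcs unchanged up to direction.
-/
theorem compatible_xor {Γ Γ' : G.OrientedRibbonGraph} {τ : V → Bool}
    (hτ : ∀ v, (τ v = false ∧ ∀ h, G.vert h = v → Γ'.rot h = Γ.rot h) ∨
      (τ v = true ∧ ∀ h, G.vert h = v → Γ'.rot h = Γ.rot.symm h))
    {ν : V → Bool} {f : (E × Bool) × Bool → Fin 2} (hf : Γ.Compatible (Γ.bubbledState ν) f) :
    Γ'.Compatible (Γ'.bubbledState fun v => xor (τ v) (ν v)) f := by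
  rw [compatible_bubbledState_iff] at hf ⊢
  refine ⟨hf.1, fun h => ?_⟩
  rcases hτ (G.vert h) with ⟨e, H⟩ | ⟨e, H⟩
  · rw [e, H h rfl]
    simpa using hf.2 h
  · have hv : G.vert (Γ.rot.symm h) = G.vert h := by
      rw [← Γ.vert_rot, Equiv.apply_symm_apply]
    have := hf.2 (Γ.rot.symm h)
    rw [hv, Equiv.apply_symm_apply] at this
    rw [e, H h rfl]
    simpa using this.symm

/-- Two ribbon graphs have the same colored states after flipping the smoothings at the vertices
with opposite rotation. The relabelling need not preserve the weight, but it does preserve the sum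
over all states. -/
theorem sum_ncard_unbalancedColorings_eq [Fintype V] [DecidableEq V] [Fintype E]
    (Γ Γ' : G.OrientedRibbonGraph) (htri : G.Trivalent) :
    ∑ ν, (Γ.unbalancedColorings ν).ncard = ∑ ν, (Γ'.unbalancedColorings ν).ncard := by
  classical
  let τ : V → Bool := fun v => decide (¬ ∀ h, G.vert h = v → Γ'.rot h = Γ.rot h)
  have hτ : ∀ v, (τ v = false ∧ ∀ h, G.vert h = v → Γ'.rot h = Γ.rot h) ∨
      (τ v = true ∧ ∀ h, G.vert h = v → Γ'.rot h = Γ.rot.symm h) := by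
    intro v
    by_cases h : ∀ h, G.vert h = v → Γ'.rot h = Γ.rot h
    · exact Or.inl ⟨by simpa [τ] using h, h⟩
    · exact Or.inr ⟨by simpa [τ] using h, (Γ.rot_eq_or_eq_symm Γ' htri v).resolve_left h⟩
  have hτ' : ∀ v, (τ v = false ∧ ∀ h, G.vert h = v → Γ.rot h = Γ'.rot h) ∨
      (τ v = true ∧ ∀ h, G.vert h = v → Γ.rot h = Γ'.rot.symm h) := by
    refine fun v => (hτ v).imp (fun H => ⟨H.1, fun h hh => (H.2 h hh).symm⟩)
      fun H => ⟨H.1, fun h hh => ?_⟩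
    rw [Equiv.eq_symm_apply, H.2 _ ((Γ.vert_rot h).trans hh), Equiv.symm_apply_apply]
  have hinv : Function.Involutive fun (ν : V → Bool) v => xor (τ v) (ν v) := by
    intro ν
    funext v
    simp
  rw [← Equiv.sum_comp hinv.toPerm fun ν => (Γ'.unbalancedColorings ν).ncard]
  refine Finset.sum_congr rfl fun ν _ => congrArg Set.ncard ?_
  ext f
  refine and_congr_left fun _ => ⟨fun hf => compatible_xor hτ hf, fun hf => ?_⟩
  have := compatible_xor (ν := fun v => xor (τ v) (ν v)) hτ' hf
  rwa [show (fun v => xor (τ v) (xor (τ v) (ν v))) = ν from hinv ν] at this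

theorem balanced_iff (f : (E × Bool) × Bool → Fin 2) (h : E × Bool) (t : Bool) :
    Balanced f h ↔ f (h, !t) = f (h, t) := by
  cases t
  · exact eq_comm
  · rfl

/-- A half-edge is balanced when the two corners next to it have the same color. Three corners with
two colors, not all equal, have exactly one pair of equal ones. -/
theorem existsUnique_balanced [Fintype E] [DecidableEq V] (Γ : G.OrientedRibbonGraph)
    (htri : G.Trivalent) {ν : V → Bool} {f : (E × Bool) × Bool → Fin 2}
    (hf : f ∈ Γ.unbalancedColorings ν) (v : V) : ∃! h, G.vert h = v ∧ Balanced f h := by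
  obtain ⟨hcomp, hunb⟩ := hf
  have hv := hunb v
  simp only [BalancedAt, not_forall] at hv
  obtain ⟨a, ha, hba⟩ := hv
  obtain ⟨-, -, h3, h4⟩ := Γ.rot_trivalent htri a
  have hc := ((Γ.compatible_bubbledState_iff ν f).1 hcomp).2
  have hvb : G.vert (Γ.rot a) = v := by rw [Γ.vert_rot, ha]
  have hvc : G.vert (Γ.rot (Γ.rot a)) = v := by rw [Γ.vert_rot, hvb]
  have e1 := hc a
  have e2 := hc (Γ.rot a)
  have e3 := hc (Γ.rot (Γ.rot a))
  rw [h3, hvc] at e3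
  rw [hvb] at e2
  rw [ha] at e1
  have b1 := balanced_iff f a (ν v)
  have b2 := balanced_iff f (Γ.rot a) (ν v)
  have b3 := balanced_iff f (Γ.rot (Γ.rot a)) (ν v)
  rw [← e3] at b1
  rw [← e1] at b2
  rw [← e2] at b3
  -- `x`, `y`, `z` are the colors of the three corners at `v`, in cyclic order.
  generalize f (a, !ν v) = x at *
  generalize f (Γ.rot a, !ν v) = y at *
  generalize f (Γ.rot (Γ.rot a), !ν v) = z at *
  rw [b1] at hba
  have hcase : (y = x ∧ z ≠ y) ∨ (y ≠ x ∧ z = y) := by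
    clear * - hba
    revert x y z
    decide
  rcases hcase with ⟨h5, h6⟩ | ⟨h5, h6⟩
  · refine ⟨Γ.rot a, ⟨hvb, b2.2 h5⟩, ?_⟩
    rintro h ⟨hh, hbal⟩
    rcases h4 h (hh.trans ha.symm) with rfl | rfl | rfl
    · exact absurd (b1.1 hbal) hba
    · rfl
    · exact absurd (b3.1 hbal) h6
  · refine ⟨Γ.rot (Γ.rot a), ⟨hvc, b3.2 h6⟩, ?_⟩
    rintro h ⟨hh, hbal⟩
    rcases h4 h (hh.trans ha.symm) with rfl | rfl | rfl
    · exact absurd (b1.1 hbal) hba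
    · exact absurd (b2.1 hbal) h5
    · rfl

/-- The band arcs carry balance from one half-edge of an edge to the other, so the balanced
half-edges form whole edges. A balanced loop would give its vertex two balanced half-edges. -/
theorem exists_isPerfectMatching [Fintype E] [DecidableEq V] (Γ : G.OrientedRibbonGraph)
    (htri : G.Trivalent) {ν : V → Bool} (hne : (Γ.unbalancedColorings ν).Nonempty) :
    ∃ M : Set E, G.IsPerfectMatching M := by
  obtain ⟨f, hf⟩ := hne
  have huniq := Γ.existsUnique_balanced htri hf
  have hband := ((Γ.compatible_bubbledState_iff ν f).1 hf.1).1
  have hM : ∀ e b, Balanced f (e, b) ↔ Balanced f (e, false) := by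
    intro e b
    cases b
    · rfl
    · unfold Balanced
      rw [hband e true false, hband e true true]
      exact eq_comm
  refine ⟨{e | Balanced f (e, false)}, fun e he hloop => ?_, fun v => ?_⟩
  · have := (huniq (G.ends e false)).unique (y₁ := (e, false)) (y₂ := (e, true)) ⟨rfl, he⟩
      ⟨hloop.symm, (hM e true).2 he⟩
    simp at this
  · obtain ⟨⟨e, b⟩, ⟨hv, hb⟩, hu⟩ := huniq v
    refine ⟨e, ⟨(hM e b).1 hb, b, hv⟩, ?_⟩
    rintro e' ⟨he', b', hv'⟩
    exact congrArg Prod.fst (hu (e', b') ⟨hv', (hM e' b').2 he'⟩)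

theorem existsUnique_mem_of_isPerfectMatching {M : Set E} (hM : G.IsPerfectMatching M) (v : V) :
    ∃! h : E × Bool, G.vert h = v ∧ h.1 ∈ M := by
  obtain ⟨e, ⟨he, b, hb⟩, hu⟩ := hM.2 v
  refine ⟨(e, b), ⟨hb, he⟩, ?_⟩
  rintro ⟨e', b'⟩ ⟨hv, he'⟩
  obtain rfl := hu e' ⟨he', b', hv⟩
  have hloop := hM.1 e' he'
  by_contra hne
  have : b' ≠ b := fun h => hne (by rw [h])
  change G.ends e' b' = v at hv
  cases b <;> cases b' <;> simp_all

theorem exists_unbalancedColorings_nonempty [Fintype E] [DecidableEq V]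
    (Γ : G.OrientedRibbonGraph) (htri : G.Trivalent) {M : Set E} (hM : G.IsPerfectMatching M) :
    ∃ ν, (Γ.unbalancedColorings ν).Nonempty := by
  classical
  have hex := existsUnique_mem_of_isPerfectMatching hM
  choose m hm hmu using hex
  have hmu' : ∀ v h, G.vert h = v → h.1 ∈ M → h = m v := fun v h hv hh => hmu v h ⟨hv, hh⟩
  have hrot : ∀ h, h.1 ∉ M → ((Γ.rot h).1 ∈ M ∧ (Γ.rot (Γ.rot h)).1 ∉ M) ∨
      ((Γ.rot h).1 ∉ M ∧ (Γ.rot (Γ.rot h)).1 ∈ M) := by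
    intro h hh
    obtain ⟨-, -, h3, h4⟩ := Γ.rot_trivalent htri h
    have hr := (Γ.rot_trivalent htri (Γ.rot h)).1
    have hv1 : G.vert (Γ.rot h) = G.vert h := Γ.vert_rot h
    have hv2 : G.vert (Γ.rot (Γ.rot h)) = G.vert h := (Γ.vert_rot _).trans hv1
    rcases h4 _ (hm (G.vert h)).1 with e | e | e
    · exact absurd (e ▸ (hm (G.vert h)).2) hh
    · refine Or.inl ⟨e ▸ (hm (G.vert h)).2, fun hc => hr ?_⟩
      exact (hmu' _ _ hv2 hc).trans e
    · refine Or.inr ⟨fun hc => hr ?_, e ▸ (hm (G.vert h)).2⟩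
      exact (e.symm.trans (hmu' _ _ hv1 hc).symm)
  let σ : E × Bool → E × Bool := fun h => (h.1, !h.2)
  have hσ : Function.Involutive σ := fun h => by simp [σ]
  have hσ' : ∀ h, σ h ≠ h := by
    rintro ⟨e, b⟩
    simp [σ]
  -- Outside `M`, `τ` passes to the other unmatched half-edge at the same vertex, so `σ` and `τ`
  -- together trace the cycles left by removing `M`, and an alternating coloring orients them. On
  -- `M` the value only has to make `τ` a fixed-point-free involution.
  let τ : E × Bool → E × Bool := fun h =>
    if h.1 ∈ M then σ h else if (Γ.rot h).1 ∈ M then Γ.rot (Γ.rot h) else Γ.rot h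
  have hτ : Function.Involutive τ := by
    intro h
    have h3 := (Γ.rot_trivalent htri h).2.2.1
    by_cases hh : h.1 ∈ M
    · have : (σ h).1 ∈ M := hh
      simp only [τ, if_pos hh, if_pos this]
      exact hσ h
    · rcases hrot h hh with ⟨h5, h6⟩ | ⟨h5, h6⟩
      · simp only [τ, if_neg hh, if_pos h5, if_neg h6, h3]
      · simp only [τ, if_neg hh, if_neg h5, if_pos h6, h3]
  have hτ' : ∀ h, τ h ≠ h := by
    intro h
    obtain ⟨h1, h2, -, -⟩ := Γ.rot_trivalent htri h
    simp only [τ]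
    split_ifs
    · exact hσ' h
    · exact h2
    · exact h1
  obtain ⟨o, ho, ho'⟩ := exists_alternating_coloring (σ := hσ.toPerm) (τ := hτ.toPerm) hσ hτ
    hσ' hτ'
  -- Matching edges have color 0 on both sides; every other edge has color 1 on exactly one side,
  -- the one selected by `o`.
  let f : (E × Bool) × Bool → Fin 2 := fun p =>
    if p.1.1 ∈ M then 0 else if o p.1 = p.2 then 1 else 0
  -- The smoothing at `v` is the one for which the corner between the two unmatched half-edges joins
  -- their strands of color 1, while the two corners next to the matching edge have color 0.
  refine ⟨fun v => !o (Γ.rot (m v)), f, ?_, fun v hbal => ?_⟩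
  · rw [compatible_bubbledState_iff]
    refine ⟨fun e b s => ?_, fun h => ?_⟩
    · have : o (e, !b) = !o (e, b) := ho (e, b)
      simp only [f, this]
      by_cases he : e ∈ M
      · simp [he]
      · simp [he]
    · obtain ⟨r1, -, h3, h4⟩ := Γ.rot_trivalent htri (m (G.vert h))
      obtain ⟨hv, hmM⟩ := hm (G.vert h)
      have hpM : (Γ.rot (m (G.vert h))).1 ∉ M := fun hc =>
        r1 (hmu' _ _ ((Γ.vert_rot _).trans hv) hc)
      have hqM : (Γ.rot (Γ.rot (m (G.vert h)))).1 ∉ M := by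
        rcases hrot _ hpM with ⟨-, h6⟩ | ⟨h5, -⟩
        · rw [h3] at h6
          exact absurd hmM h6
        · exact h5
      have hτp : o (Γ.rot (Γ.rot (m (G.vert h)))) = !o (Γ.rot (m (G.vert h))) := by
        have := ho' (Γ.rot (m (G.vert h)))
        rw [← this]
        congr 1
        simp only [Function.Involutive.coe_toPerm, τ]
        rw [if_neg hpM, if_neg hqM]
      rcases h4 h hv.symm with e | e | e
      · generalize m (G.vert h) = a at *
        subst e
        simp [f, hmM, hpM]
      · generalize m (G.vert h) = a at *
        subst e
        simp [f, hqM, hpM, hτp]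
      · generalize m (G.vert h) = a at *
        subst e
        simp [f, hqM, h3, hmM, hτp]
  · obtain ⟨r1, -, -, -⟩ := Γ.rot_trivalent htri (m v)
    obtain ⟨hv, hmM⟩ := hm v
    have hvp : G.vert (Γ.rot (m v)) = v := (Γ.vert_rot _).trans hv
    have hpM : (Γ.rot (m v)).1 ∉ M := fun hc => r1 (hmu' _ _ hvp hc)
    have := hbal _ hvp
    simp only [Balanced, f, if_neg hpM] at this
    cases h : o (Γ.rot (m v)) <;> simp [h] at this

end Multigraph.OrientedRibbonGraph

end

/-! ### The main theorem -/

theorem mainTheorem11 {V E : Type*} [Fintype V] [DecidableEq V] [Fintype E] [DecidableEq E]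
    (G : Multigraph V E) (hconn : G.Connected) (htri : G.Trivalent)
    (Γ : G.OrientedRibbonGraph) (L : G.Labelling) :
    G.totalMatching 2 = Γ.totalMatching L 2 ∧
      List.TFAE [
        ∃ M : Set E, G.IsPerfectMatching M,
        0 < G.totalMatching 2,
        ∃ i : ℕ, 0 < Module.finrank ℂ (Γ.FilteredHomology L 2 i)] := by
  have h : G.totalMatching 2 = Γ.totalMatching L 2 := by
    -- The graph invariant is evaluated at an arbitrarily chosen ribbon graph and labelling, so it
    -- has to be compared with `Γ` and `L`.
    have hne : Nonempty (G.OrientedRibbonGraph × G.Labelling) := ⟨Γ, L⟩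
    rw [Multigraph.totalMatching, dif_pos hne,
      Multigraph.OrientedRibbonGraph.totalMatching_two,
      Multigraph.OrientedRibbonGraph.totalMatching_two]
    exact Multigraph.OrientedRibbonGraph.sum_ncard_unbalancedColorings_eq _ _ htri
  refine ⟨h, ?_⟩
  -- Conditions 2 and 3 both become the existence of a state with an unbalanced coloring.
  rw [h, Γ.totalMatching_two_pos_iff L, Γ.finrank_filteredHomology_pos_iff L]
  tfae_have 1 → 2 := fun ⟨_, hM⟩ => Γ.exists_unbalancedColorings_nonempty htri hM
  tfae_have 2 → 1 := fun ⟨_, hν⟩ => Γ.exists_isPerfectMatching htri hν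
  tfae_have 2 → 3 := id
  tfae_have 3 → 2 := id
  tfae_finish
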